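/- Let $\mathfrak g$ be a Lie algebra of finite dimension $n$ over a field $\boldsymbol k$ of characteristic zero, with basis $\hat x_1,\dots,\hat x_n$. Write $S(\mathfrak g)=\boldsymbol k[x_1,\dots,x_n]$, where $x_i$ is $\hat x_i$ viewed in $S(\mathfrak g)$, and $\hat S(\mathfrak g^*)=\boldsymbol k[[\partial^1,\dots,\partial^n]]$, where $\partial^1,\dots,\partial^n$ is the dual basis; a power series $P\in\hat S(\mathfrak g^*)$ acts on $S(\mathfrak g)$ as the differential operator $P(\partial)$ with $\partial^j=\partial/\partial x_j$. Let $\hat A_n$ be the semicompleted Weyl algebra, i.e. the algebra of operators on $S(\mathfrak g)$ generated by the multiplications by $x_j$ and all $P(\partial)$. Let $\boldsymbol\phi:\mathfrak g\to\operatorname{Der}(\hat S(\mathfrak g^*))$ be a homomorphism of Lie algebras such that the matrix $\phi^j_i:=\boldsymbol\phi(-\hat x_i)(\partial^j)$ is close to the identity: the constant term of $\phi^j_i$ is $\delta^j_i$. Let $U(\mathfrak g)\sharp\hat S(\mathfrak g^*)$ be the smash product algebra for the right Hopf action $P\triangleleft u=\boldsymbol\phi(\gamma(u))(P)$ ($\gamma$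 the antipode of $U(\mathfrak g)$); it satisfies $[\partial^j,\hat x_i]=\phi^j_i$. Let $E=\Lambda^*(\mathfrak g)\otimes(U(\mathfrak g)\sharp\hat S(\mathfrak g^*))$ (the extended algebra of twisted differential forms), denote the generators of $\Lambda^*(\mathfrak g)$ by $dx_1,\dots,dx_n$, and put $d\hat x_s=\sum_j dx_j\,\phi^j_s\in E$. Let $\Lambda^*_U(\mathfrak g)=\Lambda^*(\mathfrak g)\otimes U(\mathfrak g)\subset E$. Let $F\mapsto F^\phi$ be the algebra homomorphism $E\to\Lambda^*(\mathfrak g)\otimes\hat A_n$ that is the identity on $\Lambda^*(\mathfrak g)$ and on $\hat S(\mathfrak g^*)$ and sends $\hat x_i$ to $\sum_j x_j\phi^j_i$. The algebra $\Lambda^*(\mathfrak g)\otimes\hat A_n$ acts on $\Lambda^*(\mathfrak g)\otimes S(\mathfrak g)$ by left multiplication in the first factor and by differential operators in the second; write $|0\rangle=1\otimes1$, and $F|0\rangle:=F^\phi|0\rangle$ for $F\in E$. Let $\Lambda^*_{\boldsymbol\phi}(\mathfrak g)\subset\Lambda^*(\mathfrak g)\otimes\hat A_n$ be the subalgebra generated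 by all $d\hat x_i^\phi$ and $\hat x_i^\phi$. Then there is exactly one isomorphism of coalgebras $\xi=\xi_{\boldsymbol\phi}:S(\mathfrak g)\to U(\mathfrak g)$ that is the identity on $\boldsymbol k\oplus\mathfrak g$ and corresponds to $\boldsymbol\phi$ in the sense that, for the pairing $\langle u,P\rangle=\big(P(\partial)\,\xi^{-1}(u)\big)(0)$, one has $\langle xu,P\rangle=-\langle u,\boldsymbol\phi(x)(P)\rangle$ for all $x\in\mathfrak g$, $u\in U(\mathfrak g)$, $P\in\hat S(\mathfrak g^*)$. With this $\xi$ let $\hat\partial^j=\xi\circ\partial^j\circ\xi^{-1}$ on $U(\mathfrak g)$, extended to $E$ by $\hat\partial^j(\omega\otimes uP)=\omega\otimes\hat\partial^j(u)P$ for $\omega\in\Lambda^*(\mathfrak g)$, $u\in U(\mathfrak g)$, $P\in\hat S(\mathfrak g^*)$, and let $\hat d=\sum_{i,j}d\hat x_i\,(\phi^{-1})^i_j\,\hat\partial^j:E\to E$ be the twisted exterior derivative. Let $d=\sum_j dx_j\,\partial^j$ be the usual exterior derivative on $\Lambda^*(\mathfrak g)\otimes S(\mathfrak g)$. The following hold.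 (i) The linear map $\Lambda^*_U(\mathfrak g)\to\Lambda^*(\mathfrak g)\otimes S(\mathfrak g)$, $\hat f\mapsto\hat f^\phi|0\rangle$, is an isomorphism of vector spaces with inverse $\mathrm{id}_{\Lambda^*(\mathfrak g)}\otimes\xi$. Moreover $\Lambda^*_{\boldsymbol\phi}(\mathfrak g)|0\rangle=\Lambda^*(\mathfrak g)\otimes S(\mathfrak g)$. (ii) For all $\hat f\in\Lambda^*_U(\mathfrak g)$ and $s=1,\dots,n$: $\hat d(d\hat x_s\,\hat f)=-d\hat x_s\,\hat d\hat f$ and $\hat d(dx_s\,\hat f)=-dx_s\,\hat d\hat f$. (iii) For all $\hat f\in\Lambda^*_U(\mathfrak g)$: $(\hat d\hat f)|0\rangle=d(\hat f|0\rangle)$. -/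

import Mathlib

namespace TwistedForms

open scoped TensorProduct
open MvPowerSeries (pderiv)

attribute [local instance 100] LieRing.ofAssociativeRing

noncomputable section

/-- `β! / (β - α)!`, the scalar in `∂^α x^β = (β! / (β - α)!) x^(β - α)`. -/
def fallingCoeff {n : ℕ} (β α : Fin n →₀ ℕ) : ℕ := ∏ i, (β i).descFactorial (α i)

/-- `x^β ↦ P(∂) x^β = ∑_{α + γ = β} P_α (β! / γ!) x^γ`, extended linearly. -/
def diffOp {k : Type*} [Field k] {n : ℕ} (P : MvPowerSeries (Fin n) k) :
    Module.End k (MvPolynomial (Fin n) k) :=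
  (MvPolynomial.basisMonomials (Fin n) k).constr k fun β =>
    ∑ p ∈ Finset.HasAntidiagonal.antidiagonal β,
      MvPolynomial.monomial p.2 (MvPowerSeries.coeff p.1 P * (fallingCoeff β p.1 : k))

section Aux

variable {k : Type*} [Field k] {n : ℕ}

theorem diffOp_monomial_one (P : MvPowerSeries (Fin n) k) (β : Fin n →₀ ℕ) :
    diffOp P (MvPolynomial.monomial β 1) = ∑ p ∈ Finset.HasAntidiagonal.antidiagonal β,
      MvPolynomial.monomial p.2 (MvPowerSeries.coeff p.1 P * (fallingCoeff β p.1 : k)) := by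
  have := (MvPolynomial.basisMonomials (Fin n) k).constr_basis k (fun β =>
    ∑ p ∈ Finset.HasAntidiagonal.antidiagonal β,
      MvPolynomial.monomial p.2 (MvPowerSeries.coeff p.1 P * (fallingCoeff β p.1 : k))) β
  simpa [diffOp] using this

theorem diffOp_monomial (P : MvPowerSeries (Fin n) k) (β : Fin n →₀ ℕ) (c : k) :
    diffOp P (MvPolynomial.monomial β c) = ∑ p ∈ Finset.HasAntidiagonal.antidiagonal β,
      MvPolynomial.monomial p.2 (c * (MvPowerSeries.coeff p.1 P * (fallingCoeff β p.1 : k))) := by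
  have h : MvPolynomial.monomial β c = c • MvPolynomial.monomial β (1 : k) := by
    simp [MvPolynomial.smul_monomial]
  rw [h, map_smul, diffOp_monomial_one, Finset.smul_sum]
  simp [MvPolynomial.smul_monomial]

theorem fallingCoeff_add (α α' γ : Fin n →₀ ℕ) :
    fallingCoeff (α + α' + γ) (α + α') = fallingCoeff (α + α' + γ) α' * fallingCoeff (α + γ) α := by
  simp only [fallingCoeff, ← Finset.prod_mul_distrib]
  refine Finset.prod_congr rfl fun i _ => ?_
  simp only [Finsupp.add_apply]
  rw [← Nat.descFactorial_mul_descFactorial (k := α' i) (m := α i + α' i) (by omega), mul_comm]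
  congr 2 <;> omega

theorem fallingCoeff_add_single (β δ : Fin n →₀ ℕ) (j : Fin n) :
    fallingCoeff (β + Finsupp.single j 1) (δ + Finsupp.single j 1) =
      (β j + 1) * fallingCoeff β δ := by
  classical
  simp only [fallingCoeff]
  rw [← Finset.mul_prod_erase _ _ (Finset.mem_univ j),
    ← Finset.mul_prod_erase _ (fun i => (β i).descFactorial (δ i)) (Finset.mem_univ j), ← mul_assoc]
  congr 1
  · simp only [Finsupp.add_apply, Finsupp.single_eq_same]
    exact Nat.succ_descFactorial_succ _ _
  · refine Finset.prod_congr rfl fun i hi => ?_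
    simp [Finsupp.single_eq_of_ne (Finset.ne_of_mem_erase hi)]

theorem fallingCoeff_add_single_right (β δ : Fin n →₀ ℕ) (j : Fin n) :
    fallingCoeff β (δ + Finsupp.single j 1) = (β j - δ j) * fallingCoeff β δ := by
  classical
  simp only [fallingCoeff]
  rw [← Finset.mul_prod_erase _ _ (Finset.mem_univ j),
    ← Finset.mul_prod_erase _ (fun i => (β i).descFactorial (δ i)) (Finset.mem_univ j), ← mul_assoc]
  congr 1
  · simp [Nat.descFactorial_succ]
  · refine Finset.prod_congr rfl fun i hi => ?_
    simp [Finsupp.single_eq_of_ne (Finset.ne_of_mem_erase hi)]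

theorem fallingCoeff_add_single_left (β δ : Fin n →₀ ℕ) (j : Fin n) (h : δ j = 0) :
    fallingCoeff (β + Finsupp.single j 1) δ = fallingCoeff β δ := by
  classical
  refine Finset.prod_congr rfl fun i _ => ?_
  by_cases hi : i = j
  · subst hi; simp [h]
  · simp [Finsupp.single_eq_of_ne hi]

theorem coeff_diffOp_monomial (P : MvPowerSeries (Fin n) k) (β γ : Fin n →₀ ℕ) :
    MvPolynomial.coeff γ (diffOp P (MvPolynomial.monomial β 1)) =
      if γ ≤ β then MvPowerSeries.coeff (β - γ) P * (fallingCoeff β (β - γ) : k) else 0 := by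
  classical
  rw [diffOp_monomial_one, MvPolynomial.coeff_sum]
  simp only [MvPolynomial.coeff_monomial]
  split_ifs with h
  · rw [Finset.sum_eq_single (β - γ, γ)]
    · simp
    · rintro ⟨a, c⟩ hp hne
      rw [Finset.HasAntidiagonal.mem_antidiagonal] at hp
      rw [if_neg]
      rintro rfl
      apply hne
      simp only at hp
      rw [← hp]; simp
    · intro hp
      exact absurd (Finset.HasAntidiagonal.mem_antidiagonal.2 (tsub_add_cancel_of_le h)) hp
  · refine Finset.sum_eq_zero ?_
    rintro ⟨a, c⟩ hp
    rw [Finset.HasAntidiagonal.mem_antidiagonal] at hp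
    rw [if_neg]
    rintro rfl
    exact h (hp ▸ le_add_self)

theorem diffOp_add (P Q : MvPowerSeries (Fin n) k) : diffOp (P + Q) = diffOp P + diffOp Q := by
  refine (MvPolynomial.basisMonomials (Fin n) k).ext fun β => ?_
  simp [diffOp_monomial_one, add_mul, Finset.sum_add_distrib]

theorem diffOp_algebraMap (c : k) :
    diffOp (algebraMap k (MvPowerSeries (Fin n) k) c) = algebraMap k _ c := by
  classical
  refine (MvPolynomial.basisMonomials (Fin n) k).ext fun β => ?_
  ext γ
  rw [MvPolynomial.coe_basisMonomials, coeff_diffOp_monomial, Module.algebraMap_end_apply,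
    MvPolynomial.coeff_smul, MvPolynomial.coeff_monomial, MvPowerSeries.algebraMap_apply,
    MvPowerSeries.coeff_C]
  by_cases h : β = γ
  · subst h; simp [fallingCoeff]
  · rw [if_neg h]
    split_ifs with h1 h2
    · exact absurd (le_antisymm (tsub_eq_zero_iff_le.1 h2) h1) h
    · simp
    · simp

theorem diffOp_mul (P Q : MvPowerSeries (Fin n) k) : diffOp (P * Q) = diffOp P * diffOp Q := by
  classical
  refine (MvPolynomial.basisMonomials (Fin n) k).ext fun β => ?_
  rw [MvPolynomial.coe_basisMonomials, Module.End.mul_apply, diffOp_monomial_one,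
    diffOp_monomial_one, map_sum]
  simp only [diffOp_monomial, MvPowerSeries.coeff_mul, Finset.sum_mul, map_sum]
  simp only [Finset.sum_sigma']
  refine Finset.sum_nbij' (fun p => ⟨(p.2.2, p.2.1 + p.1.2), (p.2.1, p.1.2)⟩)
    (fun p => ⟨(p.2.1 + p.1.1, p.2.2), (p.2.1, p.1.1)⟩) ?_ ?_ ?_ ?_ ?_
  · rintro ⟨⟨a, b⟩, ⟨c, d⟩⟩ h
    simp only [Finset.mem_sigma, Finset.HasAntidiagonal.mem_antidiagonal] at h ⊢
    obtain ⟨rfl, rfl⟩ := h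
    exact ⟨by abel, trivial⟩
  · rintro ⟨⟨a, b⟩, ⟨c, d⟩⟩ h
    simp only [Finset.mem_sigma, Finset.HasAntidiagonal.mem_antidiagonal] at h ⊢
    obtain ⟨rfl, rfl⟩ := h
    exact ⟨by abel, trivial⟩
  · rintro ⟨⟨a, b⟩, ⟨c, d⟩⟩ h
    simp only [Finset.mem_sigma, Finset.HasAntidiagonal.mem_antidiagonal] at h
    obtain ⟨rfl, rfl⟩ := h
    rfl
  · rintro ⟨⟨a, b⟩, ⟨c, d⟩⟩ h
    simp only [Finset.mem_sigma, Finset.HasAntidiagonal.mem_antidiagonal] at h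
    obtain ⟨rfl, rfl⟩ := h
    rfl
  · rintro ⟨⟨a, b⟩, ⟨c, d⟩⟩ h
    simp only [Finset.mem_sigma, Finset.HasAntidiagonal.mem_antidiagonal] at h
    obtain ⟨rfl, rfl⟩ := h
    simp only
    rw [fallingCoeff_add]
    push_cast
    congr 1
    ring

/-- The algebra homomorphism `P ↦ P(∂)`. -/
def diffHom : MvPowerSeries (Fin n) k →ₐ[k] Module.End k (MvPolynomial (Fin n) k) where
  toFun := diffOp
  map_one' := by simpa using diffOp_algebraMap (n := n) (1 : k)
  map_mul' := diffOp_mul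
  map_zero' := by simpa using diffOp_algebraMap (n := n) (0 : k)
  map_add' := diffOp_add
  commutes' := diffOp_algebraMap

theorem diffHom_mul_X (P : MvPowerSeries (Fin n) k) (j : Fin n) :
    diffHom P * LinearMap.mulLeft k (MvPolynomial.X j) =
      LinearMap.mulLeft k (MvPolynomial.X j) * diffHom P + diffHom (pderiv k j P) := by
  classical
  refine (MvPolynomial.basisMonomials (Fin n) k).ext fun β => ?_
  ext γ
  have hX : (MvPolynomial.X j : MvPolynomial (Fin n) k) * MvPolynomial.monomial β 1 =
      MvPolynomial.monomial (β + Finsupp.single j 1) 1 := by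
    rw [MvPolynomial.X, MvPolynomial.monomial_mul, one_mul, add_comm]
  simp only [MvPolynomial.coe_basisMonomials, Module.End.mul_apply, LinearMap.add_apply,
    LinearMap.mulLeft_apply, hX, MvPolynomial.coeff_add, MvPolynomial.coeff_X_mul',
    show ∀ Q : MvPowerSeries (Fin n) k, diffHom Q = diffOp Q from fun _ => rfl,
    coeff_diffOp_monomial, MvPowerSeries.coeff_pderiv]
  by_cases h : γ ≤ β
  · obtain ⟨δ, rfl⟩ := exists_add_of_le h
    have e1 : γ + δ + Finsupp.single j 1 - γ = δ + Finsupp.single j 1 := by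
      rw [add_assoc, add_tsub_cancel_left]
    have e2 : γ + δ - γ = δ := add_tsub_cancel_left _ _
    rw [if_pos (h.trans le_self_add), if_pos h, e1, e2, fallingCoeff_add_single]
    have e3 : (if j ∈ γ.support then if γ - Finsupp.single j 1 ≤ γ + δ then
        MvPowerSeries.coeff (γ + δ - (γ - Finsupp.single j 1)) P *
          (fallingCoeff (γ + δ) (γ + δ - (γ - Finsupp.single j 1)) : k) else 0 else 0) =
        MvPowerSeries.coeff (δ + Finsupp.single j 1) P *
          ((γ j * fallingCoeff (γ + δ) δ : ℕ) : k) := by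
      split_ifs with h1 h2
      · have h3 : Finsupp.single j 1 ≤ γ := by
          rw [Finsupp.single_le_iff]
          exact Nat.one_le_iff_ne_zero.2 (Finsupp.mem_support_iff.1 h1)
        obtain ⟨γ', rfl⟩ := exists_add_of_le h3
        have e4 : Finsupp.single j 1 + γ' + δ - (Finsupp.single j 1 + γ' - Finsupp.single j 1) =
            δ + Finsupp.single j 1 := by
          rw [add_tsub_cancel_left, add_comm (Finsupp.single j 1) γ', add_assoc,
            add_tsub_cancel_left, add_comm]
        rw [e4, fallingCoeff_add_single_right]
        simp
      · exact absurd (tsub_le_self.trans h) h2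
      · rw [Finsupp.notMem_support_iff.1 h1]; simp
    rw [e3]
    simp only [Finsupp.add_apply]
    push_cast
    ring
  · rw [if_neg h, add_zero]
    by_cases h1 : γ ≤ β + Finsupp.single j 1
    · have hj : γ j = β j + 1 := by
        by_contra hne
        apply h
        intro i
        have := h1 i
        by_cases hi : i = j
        · subst hi
          simp only [Finsupp.add_apply, Finsupp.single_eq_same] at this
          omega
        · simpa [Finsupp.single_eq_of_ne hi] using this
      have h3 : Finsupp.single j 1 ≤ γ := by rw [Finsupp.single_le_iff]; omega
      have h4 : j ∈ γ.support := by rw [Finsupp.mem_support_iff]; omega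
      rw [if_pos h1, if_pos h4]
      obtain ⟨γ', rfl⟩ := exists_add_of_le h3
      have h5 : γ' ≤ β := by
        rw [add_comm] at h1
        exact le_of_add_le_add_right h1
      obtain ⟨δ, rfl⟩ := exists_add_of_le h5
      have hδ : δ j = 0 := by simp at hj; omega
      have e1 : γ' + δ + Finsupp.single j 1 - (Finsupp.single j 1 + γ') = δ := by
        rw [add_comm (Finsupp.single j 1), add_right_comm, add_tsub_cancel_left]
      rw [add_tsub_cancel_left, if_pos h5, add_tsub_cancel_left, e1,
        fallingCoeff_add_single_left _ _ _ hδ]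
    · rw [if_neg h1]
      split_ifs with h2 h3
      · exact absurd (tsub_le_iff_right.1 h3) h1
      · rfl
      · rfl

theorem sub_C_mem_span (P : MvPowerSeries (Fin n) k) :
    P - MvPowerSeries.C (MvPowerSeries.constantCoeff P) ∈
      Ideal.span (Set.range (MvPowerSeries.X : Fin n → MvPowerSeries (Fin n) k)) := by
  classical
  have key : ∀ (s : Finset (Fin n)) (P : MvPowerSeries (Fin n) k),
      (∀ α : Fin n →₀ ℕ, (∀ i ∈ s, α i = 0) → MvPowerSeries.coeff α P = 0) →
      P ∈ Ideal.span (Set.range (MvPowerSeries.X : Fin n → MvPowerSeries (Fin n) k)) := by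
    intro s
    induction s using Finset.induction_on with
    | empty =>
      intro P h
      have : P = 0 := by ext α; simpa using h α (by simp)
      simp [this]
    | insert a s ha ih =>
      intro P h
      let Q : MvPowerSeries (Fin n) k := fun α => if α a = 0 then MvPowerSeries.coeff α P else 0
      have hQ : ∀ α, MvPowerSeries.coeff α Q = if α a = 0 then MvPowerSeries.coeff α P else 0 :=
        fun α => rfl
      have h1 : Q ∈ Ideal.span (Set.range
          (MvPowerSeries.X : Fin n → MvPowerSeries (Fin n) k)) := by
        refine ih Q fun α hα => ?_
        rw [hQ]
        split_ifs with h0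
        · exact h α (by simpa [h0] using hα)
        · rfl
      have h2 : (MvPowerSeries.X a : MvPowerSeries (Fin n) k) ∣ P - Q := by
        rw [MvPowerSeries.X_dvd_iff]
        intro m hm
        rw [map_sub, hQ, if_pos hm, sub_self]
      have h3 := Ideal.mem_of_dvd _ h2 (Ideal.subset_span (Set.mem_range_self a))
      simpa using add_mem h3 h1
  refine key Finset.univ _ fun α hα => ?_
  have : α = 0 := by ext i; simpa using hα i (Finset.mem_univ i)
  subst this
  simp

theorem derivation_eq_zero
    (E : Derivation k (MvPowerSeries (Fin n) k) (MvPowerSeries (Fin n) k))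
    (hE : ∀ i, E (MvPowerSeries.X i) = 0) (P : MvPowerSeries (Fin n) k) : E P = 0 := by
  have key : ∀ N : ℕ, ∀ P, (N : ℕ∞) ≤ (E P).order := by
    intro N
    induction N with
    | zero => intro P; simp
    | succ N ih =>
      have h1 : ∀ y ∈ Ideal.span (Set.range
          (MvPowerSeries.X : Fin n → MvPowerSeries (Fin n) k)),
          MvPowerSeries.constantCoeff y = 0 ∧ ((N + 1 : ℕ) : ℕ∞) ≤ (E y).order := by
        intro y hy
        refine Submodule.span_induction ?_ ?_ ?_ ?_ hy
        · rintro _ ⟨i, rfl⟩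
          simp [hE]
        · simp
        · intro x y _ _ hx hy
          refine ⟨by simp [hx.1, hy.1], ?_⟩
          rw [map_add]
          exact le_trans (le_min hx.2 hy.2) (MvPowerSeries.min_order_le_add)
        · intro a y _ hy
          refine ⟨by simp [hy.1], ?_⟩
          rw [smul_eq_mul, E.leibniz]
          refine le_trans (le_min ?_ ?_) (MvPowerSeries.min_order_le_add)
          · exact le_trans hy.2 (le_trans le_add_self MvPowerSeries.le_order_mul)
          · refine le_trans ?_ (MvPowerSeries.le_order_mul)
            have := ih a
            have h2 : (1 : ℕ∞) ≤ y.order := by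
              rw [MvPowerSeries.one_le_order_iff_constCoeff_eq_zero]; exact hy.1
            push_cast
            rw [add_comm]
            exact add_le_add h2 this
      intro P
      have h2 := (h1 _ (sub_C_mem_span P)).2
      have h3 : E (MvPowerSeries.C (MvPowerSeries.constantCoeff P)) = 0 :=
        E.map_algebraMap (MvPowerSeries.constantCoeff P)
      rwa [map_sub, h3, sub_zero] at h2
  rw [← MvPowerSeries.order_eq_top_iff]
  exact ENat.eq_top_iff_forall_ge.2 fun N => key N P

theorem derivation_apply
    (D : Derivation k (MvPowerSeries (Fin n) k) (MvPowerSeries (Fin n) k))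
    (P : MvPowerSeries (Fin n) k) :
    D P = ∑ j, D (MvPowerSeries.X j) * pderiv k j P := by
  classical
  have := derivation_eq_zero (D - ∑ j, D (MvPowerSeries.X j) • pderiv k j) (fun i => by
    have : ∀ (s : Finset (Fin n)) (Q), (∑ j ∈ s, D (MvPowerSeries.X j) • pderiv k j) Q =
      ∑ j ∈ s, D (MvPowerSeries.X j) * pderiv k j Q := by
        intro s Q
        rw [← Derivation.coeFnAddMonoidHom_apply, map_sum, Finset.sum_apply]; rfl
    rw [Derivation.sub_apply, this]
    simp [MvPowerSeries.pderiv_X, Pi.single_apply]) P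
  have h2 : (∑ j, D (MvPowerSeries.X j) • pderiv k j) P =
      ∑ j, D (MvPowerSeries.X j) * pderiv k j P := by
        rw [← Derivation.coeFnAddMonoidHom_apply, map_sum, Finset.sum_apply]; rfl
  rw [Derivation.sub_apply, h2] at this
  exact sub_eq_zero.1 this

end Aux

section Enveloping

variable (k : Type*) [Field k] (g : Type*) [LieRing g] [LieAlgebra k g]

/-- The coproduct of `U(g)`: the algebra map with `x ↦ x ⊗ 1 + 1 ⊗ x` for `x ∈ g`. -/
def uComul : UniversalEnvelopingAlgebra k g →ₐ[k]
    UniversalEnvelopingAlgebra k g ⊗[k] UniversalEnvelopingAlgebra k g :=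
  UniversalEnvelopingAlgebra.lift k
    { toFun := fun x => UniversalEnvelopingAlgebra.ι k x ⊗ₜ 1 + 1 ⊗ₜ UniversalEnvelopingAlgebra.ι k x
      map_add' := fun x y => by
        simp only [map_add, TensorProduct.add_tmul, TensorProduct.tmul_add]; abel
      map_smul' := fun c x => by
        simp only [map_smul, TensorProduct.smul_tmul', TensorProduct.tmul_smul, smul_add,
          RingHom.id_apply]
      map_lie' := fun {x y} => by
        simp only [LieHom.map_lie, LieRing.of_associative_ring_bracket, mul_add, add_mul,
          Algebra.TensorProduct.tmul_mul_tmul, one_mul, mul_one, TensorProduct.sub_tmul,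
          TensorProduct.tmul_sub]
        abel }

/-- The counit of `U(g)`: the algebra map with `x ↦ 0` for `x ∈ g`. -/
def uCounit : UniversalEnvelopingAlgebra k g →ₐ[k] k :=
  UniversalEnvelopingAlgebra.lift k
    { toFun := fun _ => 0
      map_add' := by simp
      map_smul' := by simp
      map_lie' := by simp }

/-- The antipode of `U(g)`: the anti-homomorphism with `x ↦ -x` for `x ∈ g`. -/
def uAntipode : UniversalEnvelopingAlgebra k g →ₐ[k] (UniversalEnvelopingAlgebra k g)ᵐᵒᵖ :=
  UniversalEnvelopingAlgebra.lift k
    { toFun := fun x => MulOpposite.op (-UniversalEnvelopingAlgebra.ι k x)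
      map_add' := fun x y => by rw [← MulOpposite.op_add, map_add, neg_add]
      map_smul' := fun c x => by
        rw [map_smul, RingHom.id_apply, ← MulOpposite.op_smul, smul_neg]
      map_lie' := fun {x y} => by
        simp only [LieHom.map_lie, LieRing.of_associative_ring_bracket, ← MulOpposite.op_mul,
          ← MulOpposite.op_sub, neg_mul_neg, neg_sub] }

variable {k g}

theorem u_induction (p : Submodule k (UniversalEnvelopingAlgebra k g)) (h1 : 1 ∈ p)
    (hx : ∀ x : g, ∀ u ∈ p, UniversalEnvelopingAlgebra.ι k x * u ∈ p)
    (u : UniversalEnvelopingAlgebra k g) : u ∈ p := by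
  let A : Subalgebra k (UniversalEnvelopingAlgebra k g) :=
    { carrier := {u | ∀ v ∈ p, u * v ∈ p}
      mul_mem' := fun {a b} ha hb v hv => by rw [mul_assoc]; exact ha _ (hb _ hv)
      add_mem' := fun {a b} ha hb v hv => by rw [add_mul]; exact add_mem (ha _ hv) (hb _ hv)
      algebraMap_mem' := fun c v hv => by
        rw [← Algebra.smul_def]; exact p.smul_mem c hv }
  let f : g →ₗ⁅k⁆ A :=
    { toFun := fun x => ⟨UniversalEnvelopingAlgebra.ι k x, hx x⟩
      map_add' := fun x y => Subtype.ext (by simp)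
      map_smul' := fun c x => Subtype.ext (by simp)
      map_lie' := fun {x y} => Subtype.ext (by
        rw [LieRing.of_associative_ring_bracket]
        simp only [LieHom.map_lie, LieRing.of_associative_ring_bracket]
        rfl) }
  have h : A.val.comp (UniversalEnvelopingAlgebra.lift k f) = AlgHom.id k _ := by
    apply UniversalEnvelopingAlgebra.hom_ext
    ext x
    change A.val (UniversalEnvelopingAlgebra.lift k f (UniversalEnvelopingAlgebra.ι k x)) = _
    rw [UniversalEnvelopingAlgebra.lift_ι_apply]
    rfl
  have h2 : u ∈ A := by
    have := (UniversalEnvelopingAlgebra.lift k f u).2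
    have e : (UniversalEnvelopingAlgebra.lift k f u : UniversalEnvelopingAlgebra k g) = u :=
      DFunLike.congr_fun h u
    rwa [e] at this
  simpa using h2 1 h1

end Enveloping

section Smash

variable {k : Type*} [Field k] {g : Type*} [LieRing g] [LieAlgebra k g] {n : ℕ}
  (φ : g →ₗ⁅k⁆ Derivation k (MvPowerSeries (Fin n) k) (MvPowerSeries (Fin n) k))

/-- The left Hopf action of `U(g)` on `Ŝ(g*) = k[[∂¹, …, ∂ⁿ]]` extending `φ`. -/
def hopfAct : UniversalEnvelopingAlgebra k g →ₐ[k] Module.End k (MvPowerSeries (Fin n) k) :=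
  UniversalEnvelopingAlgebra.lift k
    { toFun := fun x => (φ x : Module.End k (MvPowerSeries (Fin n) k))
      map_add' := fun x y => by rw [map_add]; rfl
      map_smul' := fun c x => by rw [map_smul]; rfl
      map_lie' := fun {x y} => by
        rw [LieHom.map_lie, Derivation.commutator_coe_linear_map] }

/-- The right Hopf action `P ◁ u = φ(γ(u))(P)`, as a linear map `P ↦ (u ↦ P ◁ u)`. -/
def rightAct : MvPowerSeries (Fin n) k →ₗ[k]
    UniversalEnvelopingAlgebra k g →ₗ[k] MvPowerSeries (Fin n) k :=
  ((hopfAct φ).toLinearMap ∘ₗ (MulOpposite.opLinearEquiv k).symm.toLinearMap ∘ₗ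
    (uAntipode k g).toLinearMap).flip

/-- The underlying vector space `U(g) ⊗ Ŝ(g*)` of the smash product `U(g) ♯ Ŝ(g*)`. -/
def Smash (_φ : g →ₗ⁅k⁆ Derivation k (MvPowerSeries (Fin n) k) (MvPowerSeries (Fin n) k)) :
    Type _ :=
  UniversalEnvelopingAlgebra k g ⊗[k] MvPowerSeries (Fin n) k

namespace Smash

instance : AddCommGroup (Smash φ) :=
  inferInstanceAs (AddCommGroup (UniversalEnvelopingAlgebra k g ⊗[k] MvPowerSeries (Fin n) k))

instance : Module k (Smash φ) :=
  inferInstanceAs (Module k (UniversalEnvelopingAlgebra k g ⊗[k] MvPowerSeries (Fin n) k))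

/-- The element `u ⊗ P` of `U(g) ♯ Ŝ(g*)`, bilinearly in `u` and `P`. -/
def mk : UniversalEnvelopingAlgebra k g →ₗ[k] MvPowerSeries (Fin n) k →ₗ[k] Smash φ :=
  TensorProduct.mk k _ _

/-- Linear maps out of `U(g) ♯ Ŝ(g*)` are bilinear maps on `U(g) × Ŝ(g*)`. -/
def lift {M : Type*} [AddCommMonoid M] [Module k M]
    (f : UniversalEnvelopingAlgebra k g →ₗ[k] MvPowerSeries (Fin n) k →ₗ[k] M) :
    Smash φ →ₗ[k] M :=
  TensorProduct.lift f

variable {φ} in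
theorem lift_mk {M : Type*} [AddCommMonoid M] [Module k M]
    (f : UniversalEnvelopingAlgebra k g →ₗ[k] MvPowerSeries (Fin n) k →ₗ[k] M)
    (u : UniversalEnvelopingAlgebra k g) (P : MvPowerSeries (Fin n) k) :
    lift φ f (mk φ u P) = f u P := rfl

variable {φ} in
theorem ext {M : Type*} [AddCommMonoid M] [Module k M] {F G : Smash φ →ₗ[k] M}
    (h : ∀ u P, F (mk φ u P) = G (mk φ u P)) : F = G :=
  TensorProduct.ext' h

/-- `(v₁ ⊗ v₂, P, Q) ↦ v₁ ⊗ (P ◁ v₂) Q`. -/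
def comb : UniversalEnvelopingAlgebra k g ⊗[k] UniversalEnvelopingAlgebra k g →ₗ[k]
    MvPowerSeries (Fin n) k →ₗ[k] MvPowerSeries (Fin n) k →ₗ[k] Smash φ :=
  TensorProduct.lift <| LinearMap.mk₂ k
    (fun v₁ v₂ => LinearMap.mk₂ k (fun P Q => mk φ v₁ (rightAct φ P v₂ * Q))
      (by intros; simp [add_mul]) (by intros; simp)
      (by intros; simp [mul_add]) (by intros; simp))
    (by intros; ext; simp) (by intros; ext; simp)
    (by intros; ext; simp [add_mul]) (by intros; ext; simp)

/-- Left multiplication by `P ∈ Ŝ(g*)`: `v ⊗ Q ↦ ∑ v₍₁₎ ⊗ (P ◁ v₍₂₎) Q`. -/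
def leftS : MvPowerSeries (Fin n) k →ₗ[k] Module.End k (Smash φ) :=
  LinearMap.mk₂ k (fun P z => lift φ
    (LinearMap.flip (comb φ ∘ₗ (uComul k g).toLinearMap) P) z)
    (by
      intro P P' z
      rw [← LinearMap.add_apply]
      refine DFunLike.congr_fun (ext fun u Q => ?_) z
      simp [lift_mk])
    (by
      intro c P z
      rw [← LinearMap.smul_apply]
      refine DFunLike.congr_fun (ext fun u Q => ?_) z
      simp [lift_mk])
    (by intros; simp) (by intros; simp)

/-- Left multiplication by `u ∈ U(g)`: `v ⊗ Q ↦ u v ⊗ Q`. -/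
def leftU : UniversalEnvelopingAlgebra k g →ₗ[k] Module.End k (Smash φ) :=
  LinearMap.mk₂ k (fun u z => lift φ (mk φ ∘ₗ LinearMap.mulLeft k u) z)
    (by
      intro P P' z
      rw [← LinearMap.add_apply]
      refine DFunLike.congr_fun (ext fun u Q => ?_) z
      simp [lift_mk, add_mul])
    (by
      intro c P z
      rw [← LinearMap.smul_apply]
      refine DFunLike.congr_fun (ext fun u Q => ?_) z
      simp [lift_mk])
    (by intros; simp) (by intros; simp)

/-- The smash product multiplication `(u ⊗ P)(v ⊗ Q) = ∑ u v₍₁₎ ⊗ (P ◁ v₍₂₎) Q`. -/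
def mulMap : Smash φ →ₗ[k] Module.End k (Smash φ) :=
  lift φ (LinearMap.mk₂ k (fun u P => leftU φ u * leftS φ P)
    (by intros; simp [add_mul]) (by intros; simp)
    (by intros; simp [mul_add]) (by intros; simp))

variable {φ}

theorem leftU_mk (u v : UniversalEnvelopingAlgebra k g) (Q : MvPowerSeries (Fin n) k) :
    leftU φ u (mk φ v Q) = mk φ (u * v) Q := rfl

theorem mulMap_mk (u : UniversalEnvelopingAlgebra k g) (P : MvPowerSeries (Fin n) k) :
    mulMap φ (mk φ u P) = leftU φ u * leftS φ P := rfl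

theorem leftS_mk (P Q : MvPowerSeries (Fin n) k) (v : UniversalEnvelopingAlgebra k g) :
    leftS φ P (mk φ v Q) = comb φ (uComul k g v) P Q := rfl

theorem comb_tmul (v₁ v₂ : UniversalEnvelopingAlgebra k g) (P Q : MvPowerSeries (Fin n) k) :
    comb φ (v₁ ⊗ₜ v₂) P Q = mk φ v₁ (rightAct φ P v₂ * Q) := rfl

theorem rightAct_one (P : MvPowerSeries (Fin n) k) : rightAct φ P 1 = P := by
  simp [rightAct]

theorem rightAct_ι_mul (P : MvPowerSeries (Fin n) k) (x : g)
    (u : UniversalEnvelopingAlgebra k g) :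
    rightAct φ P (UniversalEnvelopingAlgebra.ι k x * u) = rightAct φ (-φ x P) u := by
  have h1 : uAntipode k g (UniversalEnvelopingAlgebra.ι k x) =
      MulOpposite.op (-UniversalEnvelopingAlgebra.ι k x) :=
    UniversalEnvelopingAlgebra.lift_ι_apply _ _ _
  have h2 : hopfAct φ (UniversalEnvelopingAlgebra.ι k x) =
      (φ x : Module.End k (MvPowerSeries (Fin n) k)) :=
    UniversalEnvelopingAlgebra.lift_ι_apply _ _ _
  simp only [rightAct, LinearMap.flip_apply, LinearMap.comp_apply, AlgHom.toLinearMap_apply,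
    map_mul, h1, LinearEquiv.coe_coe, MulOpposite.coe_opLinearEquiv_symm, MulOpposite.unop_mul,
    MulOpposite.unop_op, map_neg, h2, Module.End.mul_apply, LinearMap.neg_apply]
  rfl

theorem leftS_mk_one (P Q : MvPowerSeries (Fin n) k) :
    leftS φ P (mk φ 1 Q) = mk φ 1 (P * Q) := by
  rw [leftS_mk, map_one, Algebra.TensorProduct.one_def, comb_tmul, rightAct_one]

theorem leftS_mul_leftU_ι (P : MvPowerSeries (Fin n) k) (x : g) :
    leftS φ P * leftU φ (UniversalEnvelopingAlgebra.ι k x) =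
      leftU φ (UniversalEnvelopingAlgebra.ι k x) * leftS φ P - leftS φ (φ x P) := by
  refine ext fun v Q => ?_
  have h1 : uComul k g (UniversalEnvelopingAlgebra.ι k x) =
      UniversalEnvelopingAlgebra.ι k x ⊗ₜ 1 + 1 ⊗ₜ UniversalEnvelopingAlgebra.ι k x :=
    UniversalEnvelopingAlgebra.lift_ι_apply _ _ _
  simp only [Module.End.mul_apply, LinearMap.sub_apply, leftU_mk, leftS_mk, map_mul, h1]
  generalize uComul k g v = w
  induction w with
  | zero => simp
  | add a b ha hb =>
    simp only [mul_add, map_add, LinearMap.add_apply] at ha hb ⊢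
    rw [ha, hb]; abel
  | tmul a b =>
    simp only [add_mul, Algebra.TensorProduct.tmul_mul_tmul, one_mul, map_add,
      LinearMap.add_apply, comb_tmul, leftU_mk, rightAct_ι_mul, map_neg, LinearMap.neg_apply,
      neg_mul, sub_eq_add_neg]

theorem leftU_mul (u v : UniversalEnvelopingAlgebra k g) :
    leftU φ (u * v) = leftU φ u * leftU φ v := by
  refine ext fun w Q => ?_
  simp only [Module.End.mul_apply, leftU_mk, mul_assoc]

theorem leftU_one : leftU φ (1 : UniversalEnvelopingAlgebra k g) = 1 := by
  refine ext fun w Q => ?_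
  simp only [Module.End.one_apply, leftU_mk, one_mul]

theorem leftS_mul (P P' : MvPowerSeries (Fin n) k) :
    leftS φ (P * P') = leftS φ P * leftS φ P' := by
  refine ext fun v Q => ?_
  suffices H : ∀ v : UniversalEnvelopingAlgebra k g, ∀ P P',
      leftS φ (P * P') (mk φ v Q) = (leftS φ P * leftS φ P') (mk φ v Q) from H v P P'
  let p : Submodule k (UniversalEnvelopingAlgebra k g) :=
    { carrier := {v | ∀ P P', leftS φ (P * P') (mk φ v Q) = (leftS φ P * leftS φ P') (mk φ v Q)}
      add_mem' := fun {a b} ha hb P P' => by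
        simp only [map_add, LinearMap.add_apply]; rw [ha, hb]
      zero_mem' := fun P P' => by simp
      smul_mem' := fun c a ha P P' => by
        simp only [map_smul, LinearMap.smul_apply]; rw [ha] }
  intro v
  refine u_induction p ?_ ?_ v
  · intro P P'
    simp only [Module.End.mul_apply, leftS_mk_one, mul_assoc]
  · intro x v hv P P'
    have e : ∀ P, leftS φ P (mk φ (UniversalEnvelopingAlgebra.ι k x * v) Q) =
        leftU φ (UniversalEnvelopingAlgebra.ι k x) (leftS φ P (mk φ v Q)) -
          leftS φ (φ x P) (mk φ v Q) := fun P =>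
      DFunLike.congr_fun (leftS_mul_leftU_ι P x) (mk φ v Q)
    have e' : ∀ P z, leftS φ P (leftU φ (UniversalEnvelopingAlgebra.ι k x) z) =
        leftU φ (UniversalEnvelopingAlgebra.ι k x) (leftS φ P z) -
          leftS φ (φ x P) z := fun P z =>
      DFunLike.congr_fun (leftS_mul_leftU_ι P x) z
    have hv' : ∀ P P', leftS φ (P * P') (mk φ v Q) = leftS φ P (leftS φ P' (mk φ v Q)) := hv
    rw [Module.End.mul_apply, e, e, map_sub, e', (φ x).leibniz, map_add, LinearMap.add_apply,
      smul_eq_mul, smul_eq_mul, mul_comm P', hv', hv', hv']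
    abel

theorem mulMap_leftU (u : UniversalEnvelopingAlgebra k g) (z : Smash φ) :
    mulMap φ (leftU φ u z) = leftU φ u * mulMap φ z := by
  have : mulMap φ ∘ₗ leftU φ u = LinearMap.mulLeft k (leftU φ u) ∘ₗ mulMap φ := by
    refine ext fun v Q => ?_
    simp only [LinearMap.comp_apply, leftU_mk, mulMap_mk, leftU_mul, LinearMap.mulLeft_apply,
      mul_assoc]
  exact DFunLike.congr_fun this z

theorem mulMap_leftS (P : MvPowerSeries (Fin n) k) (z : Smash φ) :
    mulMap φ (leftS φ P z) = leftS φ P * mulMap φ z := by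
  suffices H : mulMap φ ∘ₗ leftS φ P = LinearMap.mulLeft k (leftS φ P) ∘ₗ mulMap φ from
    DFunLike.congr_fun H z
  refine ext fun v Q => ?_
  let p : Submodule k (UniversalEnvelopingAlgebra k g) :=
    { carrier := {v | ∀ P, mulMap φ (leftS φ P (mk φ v Q)) = leftS φ P * mulMap φ (mk φ v Q)}
      add_mem' := fun {a b} ha hb P => by
        simp only [map_add, LinearMap.add_apply, mul_add]; rw [ha, hb]
      zero_mem' := fun P => by simp
      smul_mem' := fun c a ha P => by
        simp only [map_smul, LinearMap.smul_apply, mul_smul_comm]; rw [ha] }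
  refine u_induction p ?_ ?_ v P
  · intro P
    rw [leftS_mk_one, mulMap_mk, mulMap_mk, leftU_one, one_mul, one_mul, leftS_mul]
  · intro x v hv P
    have e : leftS φ P (mk φ (UniversalEnvelopingAlgebra.ι k x * v) Q) =
        leftU φ (UniversalEnvelopingAlgebra.ι k x) (leftS φ P (mk φ v Q)) -
          leftS φ (φ x P) (mk φ v Q) :=
      DFunLike.congr_fun (leftS_mul_leftU_ι P x) (mk φ v Q)
    have hv' : ∀ P, mulMap φ (leftS φ P (mk φ v Q)) = leftS φ P * mulMap φ (mk φ v Q) := hv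
    rw [e, map_sub, mulMap_leftU, hv', hv', ← leftU_mk, mulMap_leftU, ← mul_assoc, ← mul_assoc,
      leftS_mul_leftU_ι, sub_mul]

theorem mulMap_mulMap (a b : Smash φ) : mulMap φ (mulMap φ a b) = mulMap φ a * mulMap φ b := by
  suffices H : mulMap φ ∘ₗ (mulMap φ).flip b =
      LinearMap.mulRight k (mulMap φ b) ∘ₗ mulMap φ from DFunLike.congr_fun H a
  refine ext fun u P => ?_
  simp only [LinearMap.comp_apply, LinearMap.flip_apply, mulMap_mk, Module.End.mul_apply,
    mulMap_leftU, mulMap_leftS, LinearMap.mulRight_apply, mul_assoc]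

theorem mulMap_one (a : Smash φ) : mulMap φ a (mk φ 1 1) = a := by
  suffices H : (mulMap φ).flip (mk φ 1 1) = LinearMap.id from DFunLike.congr_fun H a
  refine ext fun u P => ?_
  simp only [LinearMap.flip_apply, mulMap_mk, Module.End.mul_apply, leftS_mk_one, leftU_mk,
    mul_one, LinearMap.id_apply]

theorem one_mulMap : mulMap φ (mk φ 1 1) = 1 := by
  rw [mulMap_mk, leftU_one, one_mul]
  refine ext fun v Q => ?_
  let p : Submodule k (UniversalEnvelopingAlgebra k g) :=
    LinearMap.eqLocus ((leftS φ 1 : Smash φ →ₗ[k] Smash φ) ∘ₗ (mk φ).flip Q) ((mk φ).flip Q)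
  refine u_induction p ?_ ?_ v
  · simp [p, leftS_mk_one]
  · intro x v hv
    have hv' : leftS φ 1 (mk φ v Q) = mk φ v Q := hv
    change leftS φ 1 (mk φ (UniversalEnvelopingAlgebra.ι k x * v) Q) =
      mk φ (UniversalEnvelopingAlgebra.ι k x * v) Q
    have e : leftS φ 1 (mk φ (UniversalEnvelopingAlgebra.ι k x * v) Q) =
        leftU φ (UniversalEnvelopingAlgebra.ι k x) (leftS φ 1 (mk φ v Q)) -
          leftS φ (φ x 1) (mk φ v Q) :=
      DFunLike.congr_fun (leftS_mul_leftU_ι 1 x) (mk φ v Q)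
    rw [e, hv', Derivation.map_one_eq_zero, map_zero, leftU_mk]
    simp

instance : Mul (Smash φ) := ⟨fun a b => mulMap φ a b⟩

instance : One (Smash φ) := ⟨mk φ 1 1⟩

theorem mul_def (a b : Smash φ) : a * b = mulMap φ a b := rfl

theorem one_def : (1 : Smash φ) = mk φ 1 1 := rfl

/-- The smash product algebra `U(g) ♯ Ŝ(g*)`. -/
instance : Ring (Smash φ) :=
  { (inferInstance : AddCommGroup (Smash φ)) with
    mul := fun a b => mulMap φ a b
    one := mk φ 1 1
    mul_assoc := fun a b c => DFunLike.congr_fun (mulMap_mulMap a b) c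
    one_mul := fun a => DFunLike.congr_fun one_mulMap a
    mul_one := mulMap_one
    left_distrib := fun a b c => map_add (mulMap φ a) b c
    right_distrib := fun a b c => by
      change mulMap φ (a + b) c = _
      rw [map_add]; rfl
    zero_mul := fun a => by
      change mulMap φ 0 a = _
      rw [map_zero]; rfl
    mul_zero := fun a => map_zero (mulMap φ a) }

instance : Algebra k (Smash φ) :=
  Algebra.ofModule (fun c a b => by simp only [mul_def, map_smul, LinearMap.smul_apply])
    (fun c a b => by simp only [mul_def, map_smul])

end Smash

end Smash

/-- The semicompleted Weyl algebra `Â_n`, as the algebra of operators on `S(g) = k[x₁, …, xₙ]`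
generated by the multiplications by `x_j` and all `P(∂)`, `P ∈ k[[∂¹, …, ∂ⁿ]]`
(`k` has characteristic zero, so this action is faithful). -/
def weyl (k : Type*) [Field k] (n : ℕ) : Subalgebra k (Module.End k (MvPolynomial (Fin n) k)) :=
  Algebra.adjoin k (Set.range (fun j : Fin n => LinearMap.mulLeft k (MvPolynomial.X j)) ∪
    Set.range (diffHom (k := k) (n := n)))

section Weyl

variable (k : Type*) [Field k] {n : ℕ}

/-- `x_j ∈ Â_n`. -/
def weylX (j : Fin n) : weyl k n :=
  ⟨LinearMap.mulLeft k (MvPolynomial.X j), Algebra.subset_adjoin (Or.inl ⟨j, rfl⟩)⟩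

/-- The inclusion `Ŝ(g*) → Â_n`, with `∂^j ↦ ∂^j`. -/
def weylD : MvPowerSeries (Fin n) k →ₐ[k] weyl k n :=
  diffHom.codRestrict _ fun P => Algebra.subset_adjoin (Or.inr ⟨P, rfl⟩)

variable {k}

theorem weylD_mul_weylX (P : MvPowerSeries (Fin n) k) (j : Fin n) :
    weylD k P * weylX k j = weylX k j * weylD k P + weylD k (pderiv k j P) :=
  Subtype.ext (diffHom_mul_X P j)

end Weyl

section Realization

variable {k : Type*} [Field k] {g : Type*} [LieRing g] [LieAlgebra k g] {n : ℕ}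
  (φ : g →ₗ⁅k⁆ Derivation k (MvPowerSeries (Fin n) k) (MvPowerSeries (Fin n) k))

/-- `x^φ = ∑_j x_j φ(-x)(∂^j)`. -/
def realizeLin : g →ₗ[k] weyl k n where
  toFun x := ∑ j, weylX k j * weylD k (φ (-x) (MvPowerSeries.X j))
  map_add' x y := by
    simp [neg_add, mul_add, Finset.sum_add_distrib, -neg_add_rev]
  map_smul' c x := by
    simp only [← smul_neg, map_smul, Derivation.smul_apply, RingHom.id_apply, Finset.smul_sum,
      mul_smul_comm]

theorem realizeLin_apply (x : g) :
    realizeLin φ x = ∑ j, weylX k j * weylD k (φ (-x) (MvPowerSeries.X j)) := rfl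

theorem weylD_mul_realizeLin (P : MvPowerSeries (Fin n) k) (x : g) :
    weylD k P * realizeLin φ x = realizeLin φ x * weylD k P - weylD k (φ x P) := by
  have h : φ x P = -φ (-x) P := by simp
  rw [h, map_neg, sub_neg_eq_add, derivation_apply (φ (-x)) P, realizeLin_apply, Finset.mul_sum,
    Finset.sum_mul, map_sum, ← Finset.sum_add_distrib]
  refine Finset.sum_congr rfl fun j _ => ?_
  rw [← mul_assoc, weylD_mul_weylX, add_mul, mul_assoc, mul_assoc, ← map_mul, ← map_mul,
    ← map_mul, mul_comm P, mul_comm (pderiv k j P)]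

/-- The realization `x ↦ x^φ` as a homomorphism of Lie algebras. -/
def realizeLie : g →ₗ⁅k⁆ weyl k n where
  toLinearMap := realizeLin φ
  map_lie' := fun {x y} => by
    rw [LieRing.of_associative_ring_bracket]
    change realizeLin φ ⁅x, y⁆ = realizeLin φ x * realizeLin φ y - realizeLin φ y * realizeLin φ x
    have hX : ∀ j, realizeLin φ x * weylX k j = weylX k j * realizeLin φ x +
        ∑ l, weylX k l * weylD k (pderiv k j (φ (-x) (MvPowerSeries.X l))) := by
      intro j
      rw [realizeLin_apply, Finset.sum_mul, Finset.mul_sum, ← Finset.sum_add_distrib]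
      refine Finset.sum_congr rfl fun l _ => ?_
      rw [mul_assoc, weylD_mul_weylX, mul_add, ← mul_assoc, ← mul_assoc]
      congr 2
      exact Subtype.ext (LinearMap.ext fun f => by simp [weylX]; ring)
    have hD : ∀ P, realizeLin φ x * weylD k P = weylD k P * realizeLin φ x + weylD k (φ x P) := by
      intro P; rw [weylD_mul_realizeLin]; abel
    have h1 : realizeLin φ x * realizeLin φ y = realizeLin φ y * realizeLin φ x +
        (∑ l, weylX k l * weylD k (φ (-y) (φ (-x) (MvPowerSeries.X l))) +
        ∑ l, weylX k l * weylD k (φ x (φ (-y) (MvPowerSeries.X l)))) := by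
      have e : ∑ l, weylX k l * weylD k (φ (-y) (φ (-x) (MvPowerSeries.X l))) =
          ∑ j, (∑ l, weylX k l * weylD k (pderiv k j (φ (-x) (MvPowerSeries.X l)))) *
            weylD k (φ (-y) (MvPowerSeries.X j)) := by
        simp only [Finset.sum_mul]
        rw [Finset.sum_comm]
        refine Finset.sum_congr rfl fun l _ => ?_
        rw [derivation_apply (φ (-y)), map_sum, Finset.mul_sum]
        refine Finset.sum_congr rfl fun j _ => ?_
        rw [mul_comm, map_mul, mul_assoc]
      rw [e]
      nth_rewrite 1 [realizeLin_apply φ y]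
      nth_rewrite 1 [realizeLin_apply φ y]
      rw [Finset.mul_sum, Finset.sum_mul, ← Finset.sum_add_distrib, ← Finset.sum_add_distrib]
      refine Finset.sum_congr rfl fun j _ => ?_
      rw [← mul_assoc, hX, add_mul, mul_assoc, hD, mul_add, ← mul_assoc]
      abel
    suffices h2 : realizeLin φ ⁅x, y⁆ =
        ∑ l, weylX k l * weylD k (φ (-y) (φ (-x) (MvPowerSeries.X l))) +
        ∑ l, weylX k l * weylD k (φ x (φ (-y) (MvPowerSeries.X l))) by
      rw [h1, h2]; abel
    rw [realizeLin_apply, ← Finset.sum_add_distrib]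
    refine Finset.sum_congr rfl fun l _ => ?_
    rw [← mul_add, ← map_add]
    congr 2
    rw [map_neg, LieHom.map_lie, Derivation.neg_apply, Derivation.commutator_apply]
    simp only [map_neg, Derivation.neg_apply]
    abel

/-- The realization `u ↦ u^φ`, `U(g) → Â_n`, with `x̂_i ↦ ∑_j x_j φ^j_i`. -/
def realizeU : UniversalEnvelopingAlgebra k g →ₐ[k] weyl k n :=
  UniversalEnvelopingAlgebra.lift k (realizeLie φ)

/-- `u ⊗ P ↦ u^φ P`. -/
def realizeSmashLin : Smash φ →ₗ[k] weyl k n :=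
  Smash.lift φ (LinearMap.mk₂ k (fun u P => realizeU φ u * weylD k P)
    (by intros; simp [add_mul]) (by intros; simp)
    (by intros; simp [mul_add]) (by intros; simp))

theorem realizeSmashLin_mk (u : UniversalEnvelopingAlgebra k g) (P : MvPowerSeries (Fin n) k) :
    realizeSmashLin φ (Smash.mk φ u P) = realizeU φ u * weylD k P := rfl

theorem realizeSmashLin_leftU (u : UniversalEnvelopingAlgebra k g) (z : Smash φ) :
    realizeSmashLin φ (Smash.leftU φ u z) = realizeU φ u * realizeSmashLin φ z := by
  have : realizeSmashLin φ ∘ₗ Smash.leftU φ u =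
      LinearMap.mulLeft k (realizeU φ u) ∘ₗ realizeSmashLin φ := by
    refine Smash.ext fun v Q => ?_
    simp only [LinearMap.comp_apply, Smash.leftU_mk, realizeSmashLin_mk, map_mul,
      LinearMap.mulLeft_apply, mul_assoc]
  exact DFunLike.congr_fun this z

theorem realizeSmashLin_leftS (P : MvPowerSeries (Fin n) k) (z : Smash φ) :
    realizeSmashLin φ (Smash.leftS φ P z) = weylD k P * realizeSmashLin φ z := by
  suffices H : realizeSmashLin φ ∘ₗ Smash.leftS φ P =
      LinearMap.mulLeft k (weylD k P) ∘ₗ realizeSmashLin φ from DFunLike.congr_fun H z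
  refine Smash.ext fun v Q => ?_
  let p : Submodule k (UniversalEnvelopingAlgebra k g) :=
    { carrier := {v | ∀ P, realizeSmashLin φ (Smash.leftS φ P (Smash.mk φ v Q)) =
        weylD k P * realizeSmashLin φ (Smash.mk φ v Q)}
      add_mem' := fun {a b} ha hb P => by
        simp only [map_add, LinearMap.add_apply, mul_add]; rw [ha, hb]
      zero_mem' := fun P => by simp
      smul_mem' := fun c a ha P => by
        simp only [map_smul, LinearMap.smul_apply, mul_smul_comm]; rw [ha] }
  refine u_induction p ?_ ?_ v P
  · intro P
    rw [Smash.leftS_mk_one, realizeSmashLin_mk, realizeSmashLin_mk, map_one, one_mul, one_mul,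
      map_mul]
  · intro x v hv P
    have e : Smash.leftS φ P (Smash.mk φ (UniversalEnvelopingAlgebra.ι k x * v) Q) =
        Smash.leftU φ (UniversalEnvelopingAlgebra.ι k x) (Smash.leftS φ P (Smash.mk φ v Q)) -
          Smash.leftS φ (φ x P) (Smash.mk φ v Q) :=
      DFunLike.congr_fun (Smash.leftS_mul_leftU_ι P x) (Smash.mk φ v Q)
    have hv' : ∀ P, realizeSmashLin φ (Smash.leftS φ P (Smash.mk φ v Q)) =
        weylD k P * realizeSmashLin φ (Smash.mk φ v Q) := hv
    have hx : realizeU φ (UniversalEnvelopingAlgebra.ι k x) = realizeLin φ x :=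
      UniversalEnvelopingAlgebra.lift_ι_apply _ _ _
    rw [e, map_sub, realizeSmashLin_leftU, hv', hv', ← Smash.leftU_mk, realizeSmashLin_leftU,
      ← mul_assoc, ← mul_assoc, hx, weylD_mul_realizeLin]
    exact (sub_mul (realizeLin φ x * weylD k P) (weylD k (φ x P))
      (realizeSmashLin φ (Smash.mk φ v Q))).symm

/-- The algebra map `U(g) ♯ Ŝ(g*) → Â_n` with `x̂_i ↦ ∑_j x_j φ^j_i`, `∂^j ↦ ∂^j`. -/
def realizeSmash : Smash φ →ₐ[k] weyl k n :=
  AlgHom.ofLinearMap (realizeSmashLin φ)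
    (by rw [Smash.one_def, realizeSmashLin_mk, map_one, map_one, one_mul])
    (fun a b => by
      suffices H : realizeSmashLin φ ∘ₗ (Smash.mulMap φ).flip b =
          LinearMap.mulRight k (realizeSmashLin φ b) ∘ₗ realizeSmashLin φ from
        DFunLike.congr_fun H a
      refine Smash.ext fun u P => ?_
      simp only [LinearMap.comp_apply, LinearMap.flip_apply, Smash.mulMap_mk,
        Module.End.mul_apply, realizeSmashLin_leftU, realizeSmashLin_leftS, realizeSmashLin_mk,
        LinearMap.mulRight_apply, mul_assoc])

end Realization

section Forms

variable {k : Type*} [Field k] {g : Type*} [LieRing g] [LieAlgebra k g] {n : ℕ}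
  (b : Module.Basis (Fin n) k g)
  (φ : g →ₗ⁅k⁆ Derivation k (MvPowerSeries (Fin n) k) (MvPowerSeries (Fin n) k))

/-- The matrix `φ^j_i = φ(-x̂_i)(∂^j)`, with row index `j` and column index `i`. -/
def phiMatrix : Matrix (Fin n) (Fin n) (MvPowerSeries (Fin n) k) :=
  Matrix.of fun j i => φ (-b i) (MvPowerSeries.X j)

/-- `φ` is close to the identity: `φ^j_i = δ^j_i + O(∂)`. -/
def CloseToIdentity : Prop :=
  (phiMatrix b φ).map (MvPowerSeries.constantCoeff (σ := Fin n) (R := k)) = 1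

/-- The extended algebra of twisted differential forms `Λ(g) ⊗ (U(g) ♯ Ŝ(g*))`, the generators of
`Λ(g)` being `dx₁, …, dxₙ`. -/
abbrev ExtForms : Type _ := ExteriorAlgebra k g ⊗[k] Smash φ

/-- The algebra `Λ_U(g) = Λ(g) ⊗ U(g)` of `U`-twisted differential forms, generated by the
`dx_i` and `x̂_i`. -/
abbrev UForms (k : Type*) [Field k] (g : Type*) [LieRing g] [LieAlgebra k g] : Type _ :=
  ExteriorAlgebra k g ⊗[k] UniversalEnvelopingAlgebra k g

/-- The inclusion of algebras `U(g) ⊂ U(g) ♯ Ŝ(g*)`. -/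
def smashInclU : UniversalEnvelopingAlgebra k g →ₐ[k] Smash φ :=
  AlgHom.ofLinearMap ((Smash.mk φ).flip 1) rfl fun u v => by
    have h : Smash.leftS φ 1 = 1 := by
      simpa only [Smash.mulMap_mk, Smash.leftU_one, one_mul] using Smash.one_mulMap (φ := φ)
    simp only [LinearMap.flip_apply, Smash.mul_def, Smash.mulMap_mk, h, mul_one, Smash.leftU_mk]

/-- The inclusion of algebras `Λ_U(g) ⊂ Λ(g) ⊗ (U(g) ♯ Ŝ(g*))`. -/
def inclU : UForms k g →ₐ[k] ExtForms φ :=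
  Algebra.TensorProduct.map (AlgHom.id k _) (smashInclU φ)

/-- A power series `P ∈ Ŝ(g*)` as an element of the extended algebra. -/
def ofSeries (P : MvPowerSeries (Fin n) k) : ExtForms φ := 1 ⊗ₜ Smash.mk φ 1 P

/-- The differential `dx_s`. -/
def dx (s : Fin n) : ExtForms φ := ExteriorAlgebra.ι k (b s) ⊗ₜ 1

/-- The differential `dx̂_s = ∑_j dx_j φ^j_s`. -/
def dxHat (s : Fin n) : ExtForms φ := ∑ j, dx b φ j * ofSeries φ (phiMatrix b φ j s)

/-- The realization `F ↦ F^φ`, `Λ(g) ⊗ (U(g) ♯ Ŝ(g*)) → Λ(g) ⊗ Â_n`, identity on `Λ(g)`. -/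
def realize : ExtForms φ →ₐ[k] ExteriorAlgebra k g ⊗[k] weyl k n :=
  Algebra.TensorProduct.map (AlgHom.id k _) (realizeSmash φ)

/-- The Fock space action of `Λ(g) ⊗ Â_n` on `Λ(g) ⊗ S(g)`: left multiplication in the first
tensor factor, application of differential operators in the second. -/
def fock (k : Type*) [Field k] (g : Type*) [LieRing g] [LieAlgebra k g] (n : ℕ) :
    ExteriorAlgebra k g ⊗[k] weyl k n →ₐ[k]
      Module.End k (ExteriorAlgebra k g ⊗[k] MvPolynomial (Fin n) k) :=
  (Module.endTensorEndAlgHom (R := k) (A := k)).comp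
    (Algebra.TensorProduct.map (Algebra.lmul k (ExteriorAlgebra k g)) (weyl k n).val)

/-- The vacuum projection `F ↦ F^φ |0⟩`. -/
def vacuum : ExtForms φ →ₗ[k] ExteriorAlgebra k g ⊗[k] MvPolynomial (Fin n) k :=
  (LinearMap.applyₗ (R := k) (1 ⊗ₜ 1 : ExteriorAlgebra k g ⊗[k] MvPolynomial (Fin n) k)) ∘ₗ
    (fock k g n).toLinearMap ∘ₗ (realize φ).toLinearMap

/-- The algebra `Λ_φ(g) ⊂ Λ(g) ⊗ Â_n` generated by all `dx̂_i^φ` and `x̂_i^φ`. -/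
def phiForms : Subalgebra k (ExteriorAlgebra k g ⊗[k] weyl k n) :=
  Algebra.adjoin k (Set.range (fun i => realize φ (dxHat b φ i)) ∪
    Set.range (fun i => realize φ (inclU φ (1 ⊗ₜ UniversalEnvelopingAlgebra.ι k (b i)))))

/-- The usual exterior derivative `d = ∑_j dx_j ∂^j` on `Λ(g) ⊗ S(g)`. -/
def extD : ExteriorAlgebra k g ⊗[k] MvPolynomial (Fin n) k →ₗ[k]
    ExteriorAlgebra k g ⊗[k] MvPolynomial (Fin n) k :=
  ∑ j, TensorProduct.map (LinearMap.mulLeft k (ExteriorAlgebra.ι k (b j)))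
    (MvPolynomial.pderiv j).toLinearMap

/-- The coproduct of `S(g) = k[x₁, …, xₙ]`, with `x_i ↦ x_i ⊗ 1 + 1 ⊗ x_i`. -/
def sComul (k : Type*) [Field k] (n : ℕ) : MvPolynomial (Fin n) k →ₐ[k]
    MvPolynomial (Fin n) k ⊗[k] MvPolynomial (Fin n) k :=
  MvPolynomial.aeval fun i => MvPolynomial.X i ⊗ₜ 1 + 1 ⊗ₜ MvPolynomial.X i

/-- `ξ : S(g) → U(g)` is the coalgebra isomorphism, identical on `k ⊕ g`, that corresponds to `φ`:
under the pairing `⟨u, P⟩ = (P(∂) ξ⁻¹(u))(0)` of `U(g)` with `Ŝ(g*)`, the derivation `φ(x)` is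
the negative transpose of the left multiplication by `x`, for each `x ∈ g`. -/
structure IsXi (ξ : MvPolynomial (Fin n) k ≃ₗ[k] UniversalEnvelopingAlgebra k g) : Prop where
  map_comul : ∀ f, uComul k g (ξ f) =
    TensorProduct.map ξ.toLinearMap ξ.toLinearMap (sComul k n f)
  map_counit : ∀ f, uCounit k g (ξ f) = MvPolynomial.constantCoeff f
  map_one : ξ 1 = 1
  map_X : ∀ i, ξ (MvPolynomial.X i) = UniversalEnvelopingAlgebra.ι k (b i)
  pairing : ∀ (x : g) (u : UniversalEnvelopingAlgebra k g) (P : MvPowerSeries (Fin n) k),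
    MvPolynomial.constantCoeff (diffHom P (ξ.symm (UniversalEnvelopingAlgebra.ι k x * u))) =
      -MvPolynomial.constantCoeff (diffHom (φ x P) (ξ.symm u))

/-- The deformed derivative `∂̂^j = ξ ∘ ∂^j ∘ ξ⁻¹` on `U(g)`. -/
def partialHatU (ξ : MvPolynomial (Fin n) k ≃ₗ[k] UniversalEnvelopingAlgebra k g) (j : Fin n) :
    Module.End k (UniversalEnvelopingAlgebra k g) :=
  ξ.toLinearMap ∘ₗ (MvPolynomial.pderiv j).toLinearMap ∘ₗ ξ.symm.toLinearMap

/-- The deformed derivative `∂̂^j` on the extended algebra: it agrees with `∂̂^j` on `U(g)` and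
does not affect the factors `Λ(g)` and `Ŝ(g*)`. -/
def partialHat (ξ : MvPolynomial (Fin n) k ≃ₗ[k] UniversalEnvelopingAlgebra k g) (j : Fin n) :
    Module.End k (ExtForms φ) :=
  LinearMap.lTensor (ExteriorAlgebra k g) (Smash.lift φ (Smash.mk φ ∘ₗ partialHatU ξ j))

/-- The twisted exterior derivative `d̂ = ∑_{i,j} dx̂_i (φ⁻¹)^i_j ∂̂^j`. -/
def dHat (ξ : MvPolynomial (Fin n) k ≃ₗ[k] UniversalEnvelopingAlgebra k g) :
    Module.End k (ExtForms φ) :=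
  ∑ i, ∑ j, LinearMap.mulLeft k (dxHat b φ i * ofSeries φ ((phiMatrix b φ)⁻¹ i j)) ∘ₗ
    partialHat φ ξ j

end Forms

end

end TwistedForms

/-! The theorem rests on the linear map `fockMap`, `u ↦ u^φ |0⟩` from `U(g)` to `S(g)`; the
isomorphism `ξ` is its inverse.

Bijectivity is a triangularity argument. Since `φ^j_i` has constant term `δ^j_i`, the operator
`x̂_i^φ` is multiplication by `x_i` up to terms that do not raise the degree. So a word in the
`x̂_i` is sent to the corresponding monomial plus lower terms. Words of `U(g)` can be sorted at the
cost of shorter words, so ordered words span. The composite `S(g) → U(g) → S(g)` is then the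
identity modulo lower degree, hence bijective, and both factors are bijective. The
Poincaré–Birkhoff–Witt theorem is not assumed.

The properties of `ξ` are read off the operators. Each `P(∂)` commutes with the coproduct of `S(g)`
in either leg, so `x^φ = ∑_j x_j φ(-x)(∂^j)` is a coderivation and `fockMap` is a morphism of
coalgebras. The relation `[P, x^φ] = -φ(x)(P)` in the Weyl algebra, together with the vanishing of
`x^φ f` at `0`, is the pairing condition. Conversely, that condition and `ξ 1 = 1` determine all
values `⟨u, P⟩`. These determine `ξ⁻¹` because the pairing of `S(g)` with `Ŝ(g*)` is nondegenerate
on the left in characteristic zero.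

For the forms, `φ` is an invertible matrix and `∑_i dx̂_i (φ⁻¹)^i_j = dx_j`, so `d̂ = ∑_j dx_j
∂̂^j`. Part (i) is `fockMap` tensored with `Λ(g)`, together with recovering `dx_l` from the `dx̂_i`
on the Fock space. Part (ii) follows because the `dx_j` anticommute and `∂̂^j` commutes with left
multiplication by power series, the latter being compatibility with the coproduct
(`IsXi.partialHat_ofSeries_mul`). Part (iii) is `∂̂^j = ξ ∂^j ξ⁻¹`. -/

namespace TwistedForms

open scoped TensorProduct
open MvPowerSeries (pderiv)

attribute [local instance 100] LieRing.ofAssociativeRing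

noncomputable section

/-! ### Degree filtration of the polynomial ring and unitriangular maps -/

section DegreeFiltration

variable (k : Type*) [Field k] (n : ℕ)

/-- The space of polynomials of total degree `< d`. -/
def degLT (d : ℕ) : Submodule k (MvPolynomial (Fin n) k) :=
  MvPolynomial.restrictSupport k {α | α.degree < d}

variable {k n}

theorem monomial_mem_degLT {d : ℕ} {α : Fin n →₀ ℕ} (h : α.degree < d) (c : k) :
    MvPolynomial.monomial α c ∈ degLT k n d :=
  (MvPolynomial.monomial_mem_restrictSupport k).2 (Or.inl h)

theorem degLT_mono {d e : ℕ} (h : d ≤ e) : degLT k n d ≤ degLT k n e :=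
  MvPolynomial.restrictSupport_mono k fun _ hα => lt_of_lt_of_le hα h

/-- The strict inequality in `degLT` makes the filtration start at the zero space, so inductions
along it have a trivial base case. -/
theorem degLT_zero : degLT k n 0 = ⊥ := by
  simp [degLT, MvPolynomial.restrictSupport_eq_span]

theorem degLT_le_iff {d : ℕ} {p : Submodule k (MvPolynomial (Fin n) k)} :
    degLT k n d ≤ p ↔ ∀ α : Fin n →₀ ℕ, α.degree < d → MvPolynomial.monomial α 1 ∈ p := by
  rw [degLT, MvPolynomial.restrictSupport_eq_span, Submodule.span_le]
  exact Set.image_subset_iff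

theorem exists_mem_degLT (f : MvPolynomial (Fin n) k) : ∃ d, f ∈ degLT k n d := by
  induction f using MvPolynomial.induction_on' with
  | monomial α c => exact ⟨α.degree + 1, monomial_mem_degLT (Nat.lt_succ_self _) c⟩
  | add p q hp hq =>
    obtain ⟨d, hd⟩ := hp
    obtain ⟨e, he⟩ := hq
    exact ⟨max d e, add_mem (degLT_mono (le_max_left _ _) hd) (degLT_mono (le_max_right _ _) he)⟩

theorem X_mul_mem_degLT (j : Fin n) {d : ℕ} {f : MvPolynomial (Fin n) k} (hf : f ∈ degLT k n d) :
    MvPolynomial.X j * f ∈ degLT k n (d + 1) := by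
  suffices h : degLT k n d ≤ (degLT k n (d + 1)).comap (LinearMap.mulLeft k (MvPolynomial.X j)) from
    h hf
  refine degLT_le_iff.2 fun α hα => ?_
  rw [Submodule.mem_comap, LinearMap.mulLeft_apply, MvPolynomial.X, MvPolynomial.monomial_mul]
  refine monomial_mem_degLT ?_ _
  rw [map_add, Finsupp.degree_single]
  omega

/-- A differential operator without constant term lowers the degree. -/
theorem diffHom_mem_degLT {P : MvPowerSeries (Fin n) k} (hP : MvPowerSeries.constantCoeff P = 0)
    {d : ℕ} {f : MvPolynomial (Fin n) k} (hf : f ∈ degLT k n (d + 1)) :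
    diffHom P f ∈ degLT k n d := by
  suffices h : degLT k n (d + 1) ≤ (degLT k n d).comap (diffHom P) from h hf
  refine degLT_le_iff.2 fun α hα => ?_
  change diffOp P (MvPolynomial.monomial α 1) ∈ degLT k n d
  rw [diffOp_monomial_one]
  refine Submodule.sum_mem _ ?_
  rintro ⟨β, γ⟩ hp
  rw [Finset.HasAntidiagonal.mem_antidiagonal] at hp
  -- The `∂^β` part of `P` lowers the degree by `|β|`. Only `β = 0` would fail to lower it, and its
  -- coefficient is the constant term of `P`.
  by_cases hβ : β = 0
  · subst hβ
    simp [hP]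
  · refine monomial_mem_degLT ?_ _
    have h1 := congrArg Finsupp.degree hp
    have h2 : β.degree ≠ 0 := fun h => hβ ((Finsupp.degree_eq_zero_iff β).1 h)
    simp only [map_add] at h1 ⊢
    omega

/-- An endomorphism of `S(g)` that is the identity up to terms of lower degree is bijective. -/
theorem bijective_of_sub_mem_degLT (T : Module.End k (MvPolynomial (Fin n) k))
    (hT : ∀ α : Fin n →₀ ℕ, T (MvPolynomial.monomial α 1) - MvPolynomial.monomial α 1 ∈
      degLT k n α.degree) : Function.Bijective T := by
  -- `T - 1` moves every element one step down the filtration, so it is locally nilpotent.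
  have h : ∀ d, degLT k n (d + 1) ≤ (degLT k n d).comap (T - 1) := fun d =>
    degLT_le_iff.2 fun α hα => degLT_mono (Nat.lt_succ_iff.1 hα) (hT α)
  constructor
  · refine (injective_iff_map_eq_zero T).2 fun f hf => ?_
    obtain ⟨d, hd⟩ := exists_mem_degLT f
    induction d with
    | zero => simpa [degLT_zero] using hd
    | succ d ih =>
      -- From `T f = 0` one gets `(T - 1) f = -f`, so `f` itself lies one step lower.
      have h1 := h d hd
      rw [Submodule.mem_comap, LinearMap.sub_apply, hf, Module.End.one_apply, zero_sub,
        neg_mem_iff] at h1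
      exact ih h1
  · intro f
    obtain ⟨d, hd⟩ := exists_mem_degLT f
    rw [← LinearMap.mem_range]
    induction d generalizing f with
    | zero =>
      rw [degLT_zero, Submodule.mem_bot] at hd
      rw [hd]
      exact zero_mem _
    | succ d ih =>
      -- Here `f = T f - (T - 1) f`, and the second term is in the range by induction.
      have h1 := ih _ (h d hd)
      have h2 := sub_mem (LinearMap.mem_range_self T f) h1
      simpa using h2

end DegreeFiltration

/-! ### Ordered words span the enveloping algebra -/

section Spanning

variable {k : Type*} [Field k] {g : Type*} [LieRing g] [LieAlgebra k g] {n : ℕ}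
  (b : Module.Basis (Fin n) k g)

/-- The product in `U(g)` of a word in the basis elements. -/
def wordProd (l : List (Fin n)) : UniversalEnvelopingAlgebra k g :=
  (l.map fun i => UniversalEnvelopingAlgebra.ι k (b i)).prod

theorem wordProd_cons (i : Fin n) (l : List (Fin n)) :
    wordProd b (i :: l) = UniversalEnvelopingAlgebra.ι k (b i) * wordProd b l := rfl

/-- The span in `U(g)` of the words of length `< d`. -/
def wordLT (d : ℕ) : Submodule k (UniversalEnvelopingAlgebra k g) :=
  Submodule.span k (wordProd b '' {l | l.length < d})

theorem wordProd_mem_wordLT {d : ℕ} {l : List (Fin n)} (h : l.length < d) :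
    wordProd b l ∈ wordLT b d := Submodule.subset_span ⟨l, h, rfl⟩

theorem ι_mul_mem_wordLT (x : g) {d : ℕ} {u : UniversalEnvelopingAlgebra k g}
    (hu : u ∈ wordLT b d) : UniversalEnvelopingAlgebra.ι k x * u ∈ wordLT b (d + 1) := by
  have h1 : ∀ i, wordLT b d ≤ (wordLT b (d + 1)).comap
      (LinearMap.mulLeft k (UniversalEnvelopingAlgebra.ι k (b i))) := by
    intro i
    refine Submodule.span_le.2 ?_
    rintro _ ⟨l, hl, rfl⟩
    exact wordProd_mem_wordLT b (l := i :: l) (Nat.succ_lt_succ hl)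
  rw [← b.sum_repr x, map_sum, Finset.sum_mul]
  refine Submodule.sum_mem _ fun i _ => ?_
  rw [map_smul, smul_mul_assoc]
  exact Submodule.smul_mem _ _ (h1 i hu)

/-- Permuting the letters of a word changes its product by shorter words only. -/
theorem wordProd_sub_mem_of_perm {l l' : List (Fin n)} (h : l.Perm l') :
    wordProd b l - wordProd b l' ∈ wordLT b l.length := by
  induction h with
  | nil => simp
  | cons i _ ih =>
    rw [wordProd_cons, wordProd_cons, ← mul_sub]
    exact ι_mul_mem_wordLT b _ ih
  | swap i j l =>
    -- The commutator of two adjacent letters is a single element of `g`, so the difference is a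
    -- combination of words one letter shorter.
    have e : wordProd b (j :: i :: l) - wordProd b (i :: j :: l) =
        UniversalEnvelopingAlgebra.ι k ⁅b j, b i⁆ * wordProd b l := by
      simp only [wordProd_cons, LieHom.map_lie, LieRing.of_associative_ring_bracket, sub_mul,
        mul_assoc]
    rw [e]
    exact ι_mul_mem_wordLT b _ (wordProd_mem_wordLT b (Nat.lt_succ_self _))
  | trans h₁ _ ih₁ ih₂ =>
    rw [← h₁.length_eq] at ih₂
    simpa using add_mem ih₁ ih₂

/-- The linear map `S(g) → U(g)` sending a monomial to the product of its letters, in some order. -/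
def monomialMap : MvPolynomial (Fin n) k →ₗ[k] UniversalEnvelopingAlgebra k g :=
  (MvPolynomial.basisMonomials (Fin n) k).constr k fun α =>
    wordProd b (Finsupp.toMultiset α).toList

theorem monomialMap_monomial (α : Fin n →₀ ℕ) :
    monomialMap b (MvPolynomial.monomial α 1) = wordProd b (Finsupp.toMultiset α).toList := by
  have := (MvPolynomial.basisMonomials (Fin n) k).constr_basis k
    (fun α => wordProd b (Finsupp.toMultiset α).toList) α
  simpa [monomialMap] using this

/-- This is the spanning half of Poincaré–Birkhoff–Witt. A word agrees with the chosen ordering of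
its letters up to shorter words, which are in the range by induction. -/
theorem wordLT_le_range (d : ℕ) : wordLT b d ≤ LinearMap.range (monomialMap b) := by
  induction d with
  | zero => simp [wordLT]
  | succ d ih =>
    refine Submodule.span_le.2 ?_
    rintro _ ⟨l, hl, rfl⟩
    have hl' : l.length ≤ d := Nat.lt_succ_iff.1 hl
    have h1 : l.Perm (Finsupp.toMultiset (Multiset.toFinsupp (l : Multiset (Fin n)))).toList := by
      rw [Multiset.toFinsupp_toMultiset, ← Multiset.coe_eq_coe, Multiset.coe_toList]
    have h2 := ih (Submodule.span_mono (Set.image_mono fun _ h => lt_of_lt_of_le h hl')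
      (wordProd_sub_mem_of_perm b h1))
    rw [← monomialMap_monomial] at h2
    simpa using add_mem h2 (LinearMap.mem_range_self (monomialMap b)
      (MvPolynomial.monomial (Multiset.toFinsupp (l : Multiset (Fin n))) 1))

/-- The union of the increasing spaces `wordLT b d` contains `1` and is stable under left
multiplication by `g`, so it is all of `U(g)`. -/
theorem monomialMap_surjective : Function.Surjective (monomialMap (k := k) b) := by
  intro u
  have hu : ∃ d, u ∈ wordLT b d := by
    have hmono : Monotone (wordLT b) := fun d e h =>
      Submodule.span_mono (Set.image_mono fun _ hl => lt_of_lt_of_le hl h)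
    rw [← Submodule.mem_iSup_of_directed _ hmono.directed_le]
    refine u_induction _ ?_ ?_ u
    · exact Submodule.mem_iSup_of_mem 1 (wordProd_mem_wordLT b (l := []) one_pos)
    · intro x u hu
      rw [Submodule.mem_iSup_of_directed _ hmono.directed_le] at hu
      obtain ⟨d, hd⟩ := hu
      exact Submodule.mem_iSup_of_mem (d + 1) (ι_mul_mem_wordLT b x hd)
  obtain ⟨d, hd⟩ := hu
  exact wordLT_le_range b d hd

end Spanning

/-! ### Bijectivity of the map from the enveloping algebra to the vacuum module -/

section FockMap

variable {k : Type*} [Field k] {g : Type*} [LieRing g] [LieAlgebra k g] {n : ℕ}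
  (b : Module.Basis (Fin n) k g)
  (φ : g →ₗ⁅k⁆ Derivation k (MvPowerSeries (Fin n) k) (MvPowerSeries (Fin n) k))

/-- The linear map `U(g) → S(g)`, `u ↦ u^φ |0⟩`. -/
def fockMap : UniversalEnvelopingAlgebra k g →ₗ[k] MvPolynomial (Fin n) k :=
  LinearMap.applyₗ (R := k) 1 ∘ₗ (weyl k n).val.toLinearMap ∘ₗ (realizeU φ).toLinearMap

theorem fockMap_apply (u : UniversalEnvelopingAlgebra k g) :
    fockMap φ u = (realizeU φ u : Module.End k (MvPolynomial (Fin n) k)) 1 := rfl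

theorem fockMap_one : fockMap φ 1 = 1 := by
  rw [fockMap_apply, map_one (realizeU φ)]
  rfl

theorem realizeU_ι (x : g) : realizeU φ (UniversalEnvelopingAlgebra.ι k x) = realizeLin φ x :=
  UniversalEnvelopingAlgebra.lift_ι_apply _ _ _

theorem coe_realizeLin_apply (x : g) (f : MvPolynomial (Fin n) k) :
    (realizeLin φ x : Module.End k (MvPolynomial (Fin n) k)) f =
      ∑ j, MvPolynomial.X j * diffHom (φ (-x) (MvPowerSeries.X j)) f := by
  rw [realizeLin_apply]
  simp only [AddSubmonoidClass.coe_finsetSum, LinearMap.sum_apply]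
  rfl

theorem fockMap_ι_mul (x : g) (u : UniversalEnvelopingAlgebra k g) :
    fockMap φ (UniversalEnvelopingAlgebra.ι k x * u) =
      (realizeLin φ x : Module.End k (MvPolynomial (Fin n) k)) (fockMap φ u) := by
  rw [fockMap_apply, map_mul, realizeU_ι]
  rfl

variable {b φ}

theorem CloseToIdentity.constantCoeff_phi (hφ : CloseToIdentity b φ) (j i : Fin n) :
    MvPowerSeries.constantCoeff (φ (-b i) (MvPowerSeries.X j)) = if j = i then 1 else 0 := by
  have := congrFun (congrFun hφ j) i
  rwa [Matrix.one_apply] at this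

/-- The difference is `∑_j x_j (φ^j_i - δ^j_i)`. The series in parentheses has no constant term, so
it lowers the degree, and `x_j` raises it back by one. -/
theorem CloseToIdentity.realizeLin_sub_mem (hφ : CloseToIdentity b φ) (i : Fin n) {d : ℕ}
    {f : MvPolynomial (Fin n) k} (hf : f ∈ degLT k n d) :
    (realizeLin φ (b i) : Module.End k (MvPolynomial (Fin n) k)) f - MvPolynomial.X i * f ∈
      degLT k n d := by
  cases d with
  | zero =>
    rw [degLT_zero, Submodule.mem_bot] at hf ⊢
    simp [hf]
  | succ d =>
    have e : (MvPolynomial.X i * f : MvPolynomial (Fin n) k) = ∑ j, MvPolynomial.X j *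
        diffHom (if j = i then 1 else 0) f := by
      rw [Finset.sum_eq_single i]
      · simp
      · intro j _ hj; simp [hj]
      · simp
    rw [e, coe_realizeLin_apply, ← Finset.sum_sub_distrib]
    refine Submodule.sum_mem _ fun j _ => ?_
    rw [← mul_sub, ← LinearMap.sub_apply, ← map_sub]
    refine X_mul_mem_degLT j (diffHom_mem_degLT ?_ hf)
    rw [map_sub, hφ.constantCoeff_phi]
    split_ifs <;> simp

theorem prod_X_mem_degLT (l : List (Fin n)) :
    (l.map (MvPolynomial.X (R := k))).prod ∈ degLT k n (l.length + 1) := by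
  induction l with
  | nil => exact monomial_mem_degLT (α := 0) (by simp) 1
  | cons i l ih => exact X_mul_mem_degLT i ih

theorem CloseToIdentity.fockMap_wordProd_sub_mem (hφ : CloseToIdentity b φ) (l : List (Fin n)) :
    fockMap φ (wordProd b l) - (l.map MvPolynomial.X).prod ∈ degLT k n l.length := by
  induction l with
  | nil => simp [wordProd, fockMap_one]
  | cons i l ih =>
    rw [wordProd_cons, fockMap_ι_mul, List.map_cons, List.prod_cons, List.length_cons]
    -- Let `m` be the monomial of `l` and `r` the remainder in `ih`. The difference to be bounded is
    -- `(x̂_i^φ - x_i) m + (x̂_i^φ - x_i) r + x_i r`.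
    have h1 := hφ.realizeLin_sub_mem i (prod_X_mem_degLT l)
    have h2 := degLT_mono (Nat.le_succ _) (hφ.realizeLin_sub_mem i ih)
    have h3 := X_mul_mem_degLT i ih
    have := add_mem (add_mem h1 h2) h3
    rw [map_sub] at this
    convert this using 1
    ring

/-- Composed with `monomialMap`, the map is unitriangular for the degree, hence bijective.
Surjectivity passes to `fockMap` directly, and injectivity does because `monomialMap` is onto. -/
theorem CloseToIdentity.fockMap_bijective (hφ : CloseToIdentity b φ) :
    Function.Bijective (fockMap φ) := by
  have hT : Function.Bijective (fockMap φ ∘ₗ monomialMap b) := by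
    refine bijective_of_sub_mem_degLT _ fun α => ?_
    have h := hφ.fockMap_wordProd_sub_mem (Finsupp.toMultiset α).toList
    rw [Multiset.length_toList, Finsupp.card_toMultiset] at h
    rw [LinearMap.comp_apply, monomialMap_monomial]
    have e : ((Finsupp.toMultiset α).toList.map (MvPolynomial.X (R := k))).prod =
        MvPolynomial.monomial α 1 := by
      rw [← Multiset.prod_coe, ← Multiset.map_coe, Multiset.coe_toList, MvPolynomial.monomial_eq,
        map_one, one_mul, Finset.prod_multiset_map_count, Finsupp.toFinset_toMultiset]
      simp only [Finsupp.count_toMultiset, Finsupp.prod]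
    rwa [e] at h
  refine ⟨fun u v h => ?_, Function.Surjective.of_comp hT.2⟩
  obtain ⟨f, rfl⟩ := monomialMap_surjective b u
  obtain ⟨f', rfl⟩ := monomialMap_surjective b v
  rw [hT.1 h]

end FockMap

/-! ### Differential operators, the pairing and the coproduct of the symmetric algebra -/

section Coproduct

variable {k : Type*} [Field k] {n : ℕ}

theorem diffHom_one (P : MvPowerSeries (Fin n) k) :
    diffHom P 1 = MvPolynomial.C (MvPowerSeries.constantCoeff P) := by
  change diffOp P (MvPolynomial.monomial 0 1) = _
  rw [diffOp_monomial_one]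
  simp [fallingCoeff]

theorem diffHom_X_mul (P : MvPowerSeries (Fin n) k) (j : Fin n) (f : MvPolynomial (Fin n) k) :
    diffHom P (MvPolynomial.X j * f) =
      MvPolynomial.X j * diffHom P f + diffHom (pderiv k j P) f :=
  DFunLike.congr_fun (diffHom_mul_X P j) f

theorem poly_induction (p : Submodule k (MvPolynomial (Fin n) k)) (h1 : 1 ∈ p)
    (hX : ∀ j, ∀ f ∈ p, MvPolynomial.X j * f ∈ p) (f : MvPolynomial (Fin n) k) : f ∈ p := by
  induction f using MvPolynomial.induction_on with
  | C a => simpa [MvPolynomial.smul_eq_C_mul] using p.smul_mem a h1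
  | add f f' hf hf' => exact add_mem hf hf'
  | mul_X f i hf => rw [mul_comm]; exact hX i f hf

theorem diffHom_X (j : Fin n) :
    diffHom (MvPowerSeries.X j) = (MvPolynomial.pderiv j : Derivation k _ _).toLinearMap := by
  classical
  refine LinearMap.ext fun f => ?_
  refine poly_induction (LinearMap.eqLocus _ _) ?_ ?_ f
  · change diffHom (MvPowerSeries.X j) 1 = MvPolynomial.pderiv j 1
    simp [diffHom_one]
  · intro i f hf
    change diffHom (MvPowerSeries.X j) f = MvPolynomial.pderiv j f at hf
    change diffHom (MvPowerSeries.X j) (MvPolynomial.X i * f) =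
      MvPolynomial.pderiv j (MvPolynomial.X i * f)
    rw [diffHom_X_mul, hf, Derivation.leibniz, MvPowerSeries.pderiv_X, MvPolynomial.pderiv_X]
    by_cases h : i = j
    · subst h; simp
    · simp [h, Ne.symm h]

/-- The factor `fallingCoeff α α` is `α!`: pairing with `∂^α` extracts a Taylor coefficient. -/
theorem constantCoeff_diffHom_monomial (α : Fin n →₀ ℕ) (f : MvPolynomial (Fin n) k) :
    MvPolynomial.constantCoeff (diffHom (MvPowerSeries.monomial α 1) f) =
      MvPolynomial.coeff α f * (fallingCoeff α α : k) := by
  classical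
  induction f using MvPolynomial.induction_on' with
  | add p q hp hq => simp [hp, hq, add_mul]
  | monomial β c =>
    have e : MvPolynomial.monomial β c = c • MvPolynomial.monomial β (1 : k) := by
      simp [MvPolynomial.smul_monomial]
    rw [e, map_smul]
    change MvPolynomial.coeff 0
      (c • diffOp (MvPowerSeries.monomial α (1 : k)) (MvPolynomial.monomial β 1)) = _
    rw [MvPolynomial.coeff_smul, coeff_diffOp_monomial]
    by_cases h : α = β
    · subst h; simp
    · simp [MvPowerSeries.coeff_monomial, MvPolynomial.coeff_monomial, Ne.symm h]

/-- The pairing of `S(g)` with `Ŝ(g*)` separates points of `S(g)`. -/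
theorem eq_of_constantCoeff_diffHom_eq [CharZero k] {f f' : MvPolynomial (Fin n) k}
    (h : ∀ P, MvPolynomial.constantCoeff (diffHom P f) =
      MvPolynomial.constantCoeff (diffHom P f')) : f = f' := by
  ext α
  have h1 := h (MvPowerSeries.monomial α 1)
  rw [constantCoeff_diffHom_monomial, constantCoeff_diffHom_monomial] at h1
  -- Cancelling `α!` is where characteristic zero enters.
  refine mul_right_cancel₀ ?_ h1
  rw [Nat.cast_ne_zero, fallingCoeff, Finset.prod_ne_zero_iff]
  intro i _
  rw [Nat.descFactorial_self]
  exact Nat.factorial_ne_zero _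

theorem sComul_X (j : Fin n) : sComul k n (MvPolynomial.X j) =
    MvPolynomial.X j ⊗ₜ 1 + 1 ⊗ₜ MvPolynomial.X j :=
  MvPolynomial.aeval_X _ _

/-- Differential operators commute with the coaction of `S(g)` on itself. -/
theorem sComul_diffHom (P : MvPowerSeries (Fin n) k) (f : MvPolynomial (Fin n) k) :
    sComul k n (diffHom P f) = LinearMap.rTensor _ (diffHom P) (sComul k n f) := by
  -- The claim must range over all `P` at once, since moving `P` past `x_j` produces the partial
  -- derivative of `P` in the variable `∂^j`.
  let p : Submodule k (MvPolynomial (Fin n) k) :=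
    { carrier := {f | ∀ P, sComul k n (diffHom P f) =
        LinearMap.rTensor _ (diffHom P) (sComul k n f)}
      add_mem' := fun {a b} ha hb P => by simp only [map_add]; rw [ha, hb]
      zero_mem' := fun P => by simp
      smul_mem' := fun c a ha P => by simp only [map_smul]; rw [ha] }
  refine poly_induction p ?_ ?_ f P
  · intro P
    rw [diffHom_one, map_one, Algebra.TensorProduct.one_def, LinearMap.rTensor_tmul, diffHom_one,
      ← MvPolynomial.algebraMap_eq, AlgHom.commutes, Algebra.TensorProduct.algebraMap_apply]
  · intro j f hf P
    rw [diffHom_X_mul, map_add, map_mul, map_mul, hf, hf, sComul_X]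
    generalize sComul k n f = w
    induction w with
    | zero => simp
    | add a b ha hb =>
      simp only [mul_add, map_add] at ha hb ⊢
      rw [← ha, ← hb]; abel
    | tmul a c =>
      simp only [add_mul, Algebra.TensorProduct.tmul_mul_tmul, one_mul, map_add,
        LinearMap.rTensor_tmul, diffHom_X_mul, TensorProduct.add_tmul]
      abel

/-- The counterpart in the second leg. The coderivation property of `x^φ` uses both forms, one for
each summand of the coproduct of `x_j`. -/
theorem sComul_diffHom' (P : MvPowerSeries (Fin n) k) (f : MvPolynomial (Fin n) k) :
    sComul k n (diffHom P f) = LinearMap.lTensor _ (diffHom P) (sComul k n f) := by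
  let p : Submodule k (MvPolynomial (Fin n) k) :=
    { carrier := {f | ∀ P, sComul k n (diffHom P f) =
        LinearMap.lTensor _ (diffHom P) (sComul k n f)}
      add_mem' := fun {a b} ha hb P => by simp only [map_add]; rw [ha, hb]
      zero_mem' := fun P => by simp
      smul_mem' := fun c a ha P => by simp only [map_smul]; rw [ha] }
  refine poly_induction p ?_ ?_ f P
  · intro P
    rw [diffHom_one, map_one, Algebra.TensorProduct.one_def, LinearMap.lTensor_tmul, diffHom_one,
      ← MvPolynomial.algebraMap_eq, AlgHom.commutes, Algebra.TensorProduct.algebraMap_apply',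
      Algebra.algebraMap_eq_smul_one]
  · intro j f hf P
    rw [diffHom_X_mul, map_add, map_mul, map_mul, hf, hf, sComul_X]
    generalize sComul k n f = w
    induction w with
    | zero => simp
    | add a b ha hb =>
      simp only [mul_add, map_add] at ha hb ⊢
      rw [← ha, ← hb]; abel
    | tmul a c =>
      simp only [add_mul, Algebra.TensorProduct.tmul_mul_tmul, one_mul, map_add,
        LinearMap.lTensor_tmul, diffHom_X_mul, TensorProduct.tmul_add]
      abel

end Coproduct

/-! ### Existence and uniqueness of the coalgebra isomorphism -/

section Xi

variable {k : Type*} [Field k] {g : Type*} [LieRing g] [LieAlgebra k g] {n : ℕ}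
  {b : Module.Basis (Fin n) k g}
  (φ : g →ₗ⁅k⁆ Derivation k (MvPowerSeries (Fin n) k) (MvPowerSeries (Fin n) k))

theorem uComul_ι (x : g) : uComul k g (UniversalEnvelopingAlgebra.ι k x) =
    UniversalEnvelopingAlgebra.ι k x ⊗ₜ 1 + 1 ⊗ₜ UniversalEnvelopingAlgebra.ι k x :=
  UniversalEnvelopingAlgebra.lift_ι_apply _ _ _

theorem uCounit_ι (x : g) : uCounit k g (UniversalEnvelopingAlgebra.ι k x) = 0 :=
  UniversalEnvelopingAlgebra.lift_ι_apply _ _ _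

theorem constantCoeff_realizeLin (x : g) (f : MvPolynomial (Fin n) k) :
    MvPolynomial.constantCoeff ((realizeLin φ x : Module.End k (MvPolynomial (Fin n) k)) f) = 0 := by
  simp [coe_realizeLin_apply]

/-- `x^φ` is a coderivation of `S(g)`. -/
theorem sComul_realizeLin (x : g) (f : MvPolynomial (Fin n) k) :
    sComul k n ((realizeLin φ x : Module.End k (MvPolynomial (Fin n) k)) f) =
      LinearMap.rTensor _ (realizeLin φ x : Module.End k (MvPolynomial (Fin n) k))
        (sComul k n f) +
      LinearMap.lTensor _ (realizeLin φ x : Module.End k (MvPolynomial (Fin n) k))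
        (sComul k n f) := by
  -- The differential operator is placed in the same leg as its `x_j`: the first for `x_j ⊗ 1`, the
  -- second for `1 ⊗ x_j`.
  have h1 : sComul k n ((realizeLin φ x : Module.End k (MvPolynomial (Fin n) k)) f) =
      ∑ j, ((MvPolynomial.X j ⊗ₜ 1) *
          LinearMap.rTensor _ (diffHom (φ (-x) (MvPowerSeries.X j))) (sComul k n f) +
        (1 ⊗ₜ MvPolynomial.X j) *
          LinearMap.lTensor _ (diffHom (φ (-x) (MvPowerSeries.X j))) (sComul k n f)) := by
    rw [coe_realizeLin_apply, map_sum]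
    refine Finset.sum_congr rfl fun j _ => ?_
    rw [map_mul, sComul_X, add_mul, ← sComul_diffHom, ← sComul_diffHom']
  rw [h1]
  generalize sComul k n f = w
  induction w with
  | zero => simp
  | add a c ha hc =>
    simp only [map_add, mul_add, Finset.sum_add_distrib] at ha hc ⊢
    rw [add_add_add_comm, ha, hc]; abel
  | tmul a c =>
    simp only [LinearMap.rTensor_tmul, LinearMap.lTensor_tmul, coe_realizeLin_apply,
      Algebra.TensorProduct.tmul_mul_tmul, one_mul, Finset.sum_add_distrib,
      TensorProduct.sum_tmul, TensorProduct.tmul_sum]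

/-- `u ↦ u^φ |0⟩` is a morphism of coalgebras. -/
theorem sComul_fockMap (u : UniversalEnvelopingAlgebra k g) :
    sComul k n (fockMap φ u) =
      TensorProduct.map (fockMap φ) (fockMap φ) (uComul k g u) := by
  refine u_induction (LinearMap.eqLocus ((sComul k n).toLinearMap ∘ₗ fockMap φ)
    (TensorProduct.map (fockMap φ) (fockMap φ) ∘ₗ (uComul k g).toLinearMap)) ?_ ?_ u
  · simp [fockMap_one, Algebra.TensorProduct.one_def]
  · intro x u hu
    change sComul k n (fockMap φ u) = TensorProduct.map (fockMap φ) (fockMap φ) (uComul k g u) at hu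
    change sComul k n (fockMap φ (UniversalEnvelopingAlgebra.ι k x * u)) =
      TensorProduct.map (fockMap φ) (fockMap φ)
        (uComul k g (UniversalEnvelopingAlgebra.ι k x * u))
    rw [fockMap_ι_mul, sComul_realizeLin, hu, map_mul, uComul_ι]
    generalize uComul k g u = w
    induction w with
    | zero => simp
    | add a c ha hc =>
      simp only [map_add, mul_add] at ha hc ⊢
      rw [← ha, ← hc]; abel
    | tmul a c =>
      simp only [add_mul, Algebra.TensorProduct.tmul_mul_tmul, one_mul, map_add,
        TensorProduct.map_tmul, fockMap_ι_mul, LinearMap.rTensor_tmul, LinearMap.lTensor_tmul]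

theorem constantCoeff_fockMap (u : UniversalEnvelopingAlgebra k g) :
    MvPolynomial.constantCoeff (fockMap φ u) = uCounit k g u := by
  let p : Submodule k (UniversalEnvelopingAlgebra k g) :=
    { carrier := {u | MvPolynomial.constantCoeff (fockMap φ u) = uCounit k g u}
      add_mem' := fun {a b} ha hb => by
        change MvPolynomial.constantCoeff (fockMap φ (a + b)) = uCounit k g (a + b)
        rw [map_add, map_add, map_add, ha, hb]
      zero_mem' := by simp
      smul_mem' := fun c a ha => by
        change MvPolynomial.constantCoeff (fockMap φ (c • a)) = uCounit k g (c • a)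
        rw [map_smul, map_smul (uCounit k g), MvPolynomial.constantCoeff_smul, ha] }
  refine u_induction p ?_ ?_ u
  · simp [p, fockMap_one]
  · intro x u _
    change MvPolynomial.constantCoeff (fockMap φ (UniversalEnvelopingAlgebra.ι k x * u)) =
      uCounit k g (UniversalEnvelopingAlgebra.ι k x * u)
    rw [fockMap_ι_mul, constantCoeff_realizeLin, map_mul, uCounit_ι, zero_mul]

/-- `φ(x)` is the negative transpose of the left multiplication by `x`. -/
theorem constantCoeff_diffHom_fockMap_ι_mul (x : g) (u : UniversalEnvelopingAlgebra k g)
    (P : MvPowerSeries (Fin n) k) :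
    MvPolynomial.constantCoeff
        (diffHom P (fockMap φ (UniversalEnvelopingAlgebra.ι k x * u))) =
      -MvPolynomial.constantCoeff (diffHom (φ x P) (fockMap φ u)) := by
  -- This is `[P, x^φ] = -φ(x)(P)`. The term with `x^φ` on the left has no constant coefficient, so
  -- it drops out of the pairing.
  have h : diffHom P ((realizeLin φ x : Module.End k (MvPolynomial (Fin n) k)) (fockMap φ u)) =
      (realizeLin φ x : Module.End k (MvPolynomial (Fin n) k)) (diffHom P (fockMap φ u)) -
        diffHom (φ x P) (fockMap φ u) :=
    DFunLike.congr_fun (congrArg Subtype.val (weylD_mul_realizeLin φ P x)) (fockMap φ u)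
  rw [fockMap_ι_mul, h, map_sub, constantCoeff_realizeLin, zero_sub]

variable {φ}

/-- The pairing condition is a recursion on `u` that starts from `ξ 1 = 1`. `fockMap` satisfies the
same recursion, and the pairing separates points of `S(g)`. -/
theorem IsXi.symm_apply [CharZero k]
    {ξ : MvPolynomial (Fin n) k ≃ₗ[k] UniversalEnvelopingAlgebra k g} (hξ : IsXi b φ ξ)
    (u : UniversalEnvelopingAlgebra k g) : ξ.symm u = fockMap φ u := by
  refine eq_of_constantCoeff_diffHom_eq fun P => ?_
  -- All `P` are treated together because the recursion replaces `P` by `φ(x)(P)`.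
  let p : Submodule k (UniversalEnvelopingAlgebra k g) :=
    { carrier := {u | ∀ P, MvPolynomial.constantCoeff (diffHom P (ξ.symm u)) =
        MvPolynomial.constantCoeff (diffHom P (fockMap φ u))}
      add_mem' := fun {a b} ha hb P => by simp only [map_add]; rw [ha, hb]
      zero_mem' := fun P => by simp
      smul_mem' := fun c a ha P => by
        simp only [map_smul, MvPolynomial.constantCoeff_smul]; rw [ha] }
  refine u_induction p ?_ ?_ u P
  · intro P
    rw [fockMap_one, ← hξ.map_one, LinearEquiv.symm_apply_apply]
  · intro x u hu P
    rw [hξ.pairing, constantCoeff_diffHom_fockMap_ι_mul, hu]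

/-- The coalgebra isomorphism `ξ : S(g) → U(g)` corresponding to `φ`. -/
def CloseToIdentity.xi (hφ : CloseToIdentity b φ) :
    MvPolynomial (Fin n) k ≃ₗ[k] UniversalEnvelopingAlgebra k g :=
  (LinearEquiv.ofBijective (fockMap φ) hφ.fockMap_bijective).symm

theorem CloseToIdentity.xi_symm_apply (hφ : CloseToIdentity b φ)
    (u : UniversalEnvelopingAlgebra k g) : hφ.xi.symm u = fockMap φ u := rfl

theorem CloseToIdentity.isXi (hφ : CloseToIdentity b φ) : IsXi b φ hφ.xi where
  map_comul f := by
    obtain ⟨u, rfl⟩ := hφ.xi.symm.surjective f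
    rw [LinearEquiv.apply_symm_apply, hφ.xi_symm_apply, sComul_fockMap, ← LinearMap.comp_apply,
      ← TensorProduct.map_comp]
    have : hφ.xi.toLinearMap ∘ₗ fockMap φ = LinearMap.id :=
      LinearMap.ext fun u => hφ.xi.apply_symm_apply u
    rw [this, TensorProduct.map_id, LinearMap.id_apply]
  map_counit f := by
    obtain ⟨u, rfl⟩ := hφ.xi.symm.surjective f
    rw [LinearEquiv.apply_symm_apply, hφ.xi_symm_apply, constantCoeff_fockMap]
  map_one := by
    rw [← LinearEquiv.eq_symm_apply, hφ.xi_symm_apply, fockMap_one]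
  map_X i := by
    -- On `1` only the constant terms `φ^j_i(0) = δ^j_i` act, so `x̂_i^φ 1 = x_i`.
    rw [← LinearEquiv.eq_symm_apply, hφ.xi_symm_apply, ← mul_one (UniversalEnvelopingAlgebra.ι k _),
      fockMap_ι_mul, fockMap_one, coe_realizeLin_apply, Finset.sum_eq_single i]
    · simp only [diffHom_one, hφ.constantCoeff_phi]
      simp
    · intro j _ hj
      simp only [diffHom_one, hφ.constantCoeff_phi]
      simp [hj]
    · simp
  pairing x u P := constantCoeff_diffHom_fockMap_ι_mul φ x u P

theorem IsXi.eq_xi [CharZero k] (hφ : CloseToIdentity b φ)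
    {ξ : MvPolynomial (Fin n) k ≃ₗ[k] UniversalEnvelopingAlgebra k g} (hξ : IsXi b φ ξ) :
    ξ = hφ.xi := by
  have h : ξ.symm = hφ.xi.symm := LinearEquiv.ext fun u => hξ.symm_apply u
  rw [← ξ.symm_symm, h, LinearEquiv.symm_symm]

end Xi

/-! ### The twisted exterior derivative, the vacuum map and the algebra of twisted forms -/

section Forms

variable {k : Type*} [Field k] {g : Type*} [LieRing g] [LieAlgebra k g] {n : ℕ}
  {b : Module.Basis (Fin n) k g}
  {φ : g →ₗ⁅k⁆ Derivation k (MvPowerSeries (Fin n) k) (MvPowerSeries (Fin n) k)}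

/-- The determinant has constant term `det 1 = 1`, so it is a unit among power series. -/
theorem CloseToIdentity.phiMatrix_mul_inv (hφ : CloseToIdentity b φ) :
    phiMatrix b φ * (phiMatrix b φ)⁻¹ = 1 := by
  refine Matrix.mul_nonsing_inv _ (MvPowerSeries.isUnit_iff_constantCoeff.2 ?_)
  rw [RingHom.map_det, RingHom.mapMatrix_apply]
  rw [show (phiMatrix b φ).map _ = 1 from hφ, Matrix.det_one]
  exact isUnit_one

theorem ofSeries_mul (P Q : MvPowerSeries (Fin n) k) :
    ofSeries φ P * ofSeries φ Q = ofSeries φ (P * Q) := by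
  rw [ofSeries, ofSeries, Algebra.TensorProduct.tmul_mul_tmul, one_mul, Smash.mul_def,
    Smash.mulMap_mk, Smash.leftU_one, one_mul, Smash.leftS_mk_one, ofSeries]

theorem CloseToIdentity.sum_dxHat_mul (hφ : CloseToIdentity b φ) (j : Fin n) :
    ∑ i, dxHat b φ i * ofSeries φ ((phiMatrix b φ)⁻¹ i j) = dx b φ j := by
  classical
  have e : ∀ l, ∑ i, ofSeries φ (phiMatrix b φ l i * (phiMatrix b φ)⁻¹ i j) =
      if l = j then 1 else 0 := by
    intro l
    have := congrFun (congrFun hφ.phiMatrix_mul_inv l) j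
    rw [Matrix.mul_apply, Matrix.one_apply] at this
    simp only [ofSeries]
    rw [← TensorProduct.tmul_sum, ← map_sum, this]
    split_ifs
    · rfl
    · simp
  simp only [dxHat, Finset.sum_mul, mul_assoc, ofSeries_mul]
  rw [Finset.sum_comm]
  simp only [← Finset.mul_sum, e]
  simp

/-- The factor `φ⁻¹` undoes the matrix in `dx̂_i`. The resulting form of `d̂` is the one used for
(ii) and (iii). -/
theorem CloseToIdentity.dHat_apply (hφ : CloseToIdentity b φ)
    (ξ : MvPolynomial (Fin n) k ≃ₗ[k] UniversalEnvelopingAlgebra k g) (F : ExtForms φ) :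
    dHat b φ ξ F = ∑ j, dx b φ j * partialHat φ ξ j F := by
  simp only [dHat, LinearMap.sum_apply, LinearMap.comp_apply, LinearMap.mulLeft_apply]
  rw [Finset.sum_comm]
  simp only [← Finset.sum_mul, hφ.sum_dxHat_mul]

theorem partialHat_dx_mul (ξ : MvPolynomial (Fin n) k ≃ₗ[k] UniversalEnvelopingAlgebra k g)
    (j s : Fin n) (F : ExtForms φ) :
    partialHat φ ξ j (dx b φ s * F) = dx b φ s * partialHat φ ξ j F := by
  induction F using TensorProduct.induction_on with
  | zero => simp
  | add a c ha hc => simp only [mul_add, map_add, ha, hc]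
  | tmul a c =>
    simp only [partialHat, dx, LinearMap.lTensor_tmul, Algebra.TensorProduct.tmul_mul_tmul, one_mul]

theorem dx_mul_dx (j s : Fin n) : dx b φ j * dx b φ s = -(dx b φ s * dx b φ j) := by
  simp only [dx, Algebra.TensorProduct.tmul_mul_tmul, one_mul]
  rw [← TensorProduct.neg_tmul, eq_neg_of_add_eq_zero_left (ExteriorAlgebra.ι_add_mul_swap _ _)]

theorem CloseToIdentity.dHat_dx_mul (hφ : CloseToIdentity b φ)
    (ξ : MvPolynomial (Fin n) k ≃ₗ[k] UniversalEnvelopingAlgebra k g) (s : Fin n)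
    (F : ExtForms φ) : dHat b φ ξ (dx b φ s * F) = -(dx b φ s * dHat b φ ξ F) := by
  rw [hφ.dHat_apply, hφ.dHat_apply, Finset.mul_sum, ← Finset.sum_neg_distrib]
  refine Finset.sum_congr rfl fun j _ => ?_
  rw [partialHat_dx_mul, ← mul_assoc, ← mul_assoc, dx_mul_dx]
  exact neg_mul (dx b φ s * dx b φ j) (partialHat φ ξ j F)

/-- Transport along the coalgebra map `ξ` of the fact that `∂^j` passes through the coproduct of
`S(g)` in the first leg. -/
theorem IsXi.uComul_partialHatU
    {ξ : MvPolynomial (Fin n) k ≃ₗ[k] UniversalEnvelopingAlgebra k g} (hξ : IsXi b φ ξ)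
    (j : Fin n) (u : UniversalEnvelopingAlgebra k g) :
    uComul k g (partialHatU ξ j u) = LinearMap.rTensor _ (partialHatU ξ j) (uComul k g u) := by
  obtain ⟨f, rfl⟩ := ξ.surjective u
  have h : partialHatU ξ j (ξ f) = ξ (diffHom (MvPowerSeries.X j) f) := by
    simp [partialHatU, diffHom_X]
  rw [h, hξ.map_comul, hξ.map_comul, sComul_diffHom, ← LinearMap.comp_apply,
    ← LinearMap.comp_apply, LinearMap.map_comp_rTensor, LinearMap.rTensor_comp_map]
  congr 2
  refine LinearMap.ext fun f => ?_
  simp [partialHatU, diffHom_X]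

/-- In the smash product `P · (u ⊗ Q) = ∑ u₍₁₎ ⊗ (P ◁ u₍₂₎) Q`. By `IsXi.uComul_partialHatU`,
applying `∂̂^j` to `u` affects only `u₍₁₎`, so it commutes with this operation. -/
theorem IsXi.partialHat_ofSeries_mul
    {ξ : MvPolynomial (Fin n) k ≃ₗ[k] UniversalEnvelopingAlgebra k g} (hξ : IsXi b φ ξ)
    (j : Fin n) (P : MvPowerSeries (Fin n) k) (F : ExtForms φ) :
    partialHat φ ξ j (ofSeries φ P * F) = ofSeries φ P * partialHat φ ξ j F := by
  have key : Smash.lift φ (Smash.mk φ ∘ₗ partialHatU ξ j) ∘ₗ Smash.leftS φ P =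
      Smash.leftS φ P ∘ₗ Smash.lift φ (Smash.mk φ ∘ₗ partialHatU ξ j) := by
    refine Smash.ext fun u Q => ?_
    simp only [LinearMap.comp_apply, Smash.lift_mk, Smash.leftS_mk, hξ.uComul_partialHatU]
    generalize uComul k g u = w
    induction w with
    | zero => simp
    | add a c ha hc => simp only [map_add, LinearMap.add_apply, ha, hc]
    | tmul a c =>
      simp only [LinearMap.rTensor_tmul, Smash.comb_tmul, Smash.lift_mk, LinearMap.comp_apply]
  have hmul : ∀ z : Smash φ, Smash.mk φ 1 P * z = Smash.leftS φ P z := fun z => by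
    rw [Smash.mul_def, Smash.mulMap_mk, Smash.leftU_one, one_mul]
  induction F using TensorProduct.induction_on with
  | zero => simp
  | add a c ha hc => simp only [mul_add, map_add, ha, hc]
  | tmul a c =>
    simp only [partialHat, ofSeries, LinearMap.lTensor_tmul, Algebra.TensorProduct.tmul_mul_tmul,
      one_mul, hmul]
    rw [← LinearMap.comp_apply, key, LinearMap.comp_apply]

theorem ofSeries_mul_dx (P : MvPowerSeries (Fin n) k) (s : Fin n) :
    ofSeries φ P * dx b φ s = dx b φ s * ofSeries φ P := by
  simp only [ofSeries, dx, Algebra.TensorProduct.tmul_mul_tmul, one_mul, mul_one]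

/-- Each summand of `dx̂_s` is `dx_l` times a power series: `d̂` changes sign past the first factor
and commutes with the second. -/
theorem IsXi.dHat_dxHat_mul (hφ : CloseToIdentity b φ)
    {ξ : MvPolynomial (Fin n) k ≃ₗ[k] UniversalEnvelopingAlgebra k g} (hξ : IsXi b φ ξ)
    (s : Fin n) (F : ExtForms φ) :
    dHat b φ ξ (dxHat b φ s * F) = -(dxHat b φ s * dHat b φ ξ F) := by
  rw [dxHat, Finset.sum_mul, map_sum, Finset.sum_mul, ← Finset.sum_neg_distrib]
  refine Finset.sum_congr rfl fun l _ => ?_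
  rw [mul_assoc, hφ.dHat_dx_mul, mul_assoc, hφ.dHat_apply, hφ.dHat_apply]
  congr 2
  rw [Finset.mul_sum]
  refine Finset.sum_congr rfl fun j _ => ?_
  rw [hξ.partialHat_ofSeries_mul, ← mul_assoc, ← mul_assoc, ofSeries_mul_dx]

theorem fock_tmul (ω η : ExteriorAlgebra k g) (a : weyl k n) (f : MvPolynomial (Fin n) k) :
    fock k g n (ω ⊗ₜ a) (η ⊗ₜ f) =
      (ω * η) ⊗ₜ (a : Module.End k (MvPolynomial (Fin n) k)) f := rfl

theorem vacuum_inclU_tmul (ω : ExteriorAlgebra k g) (u : UniversalEnvelopingAlgebra k g) :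
    vacuum φ (inclU φ (ω ⊗ₜ u)) = ω ⊗ₜ fockMap φ u := by
  change fock k g n (ω ⊗ₜ realizeSmashLin φ (Smash.mk φ u 1)) (1 ⊗ₜ 1) = _
  rw [fock_tmul, mul_one, realizeSmashLin_mk, map_one (weylD k), mul_one, fockMap_apply]

/-- This reduces the isomorphism in (i) to the bijectivity of `fockMap`. -/
theorem vacuum_inclU (f : UForms k g) :
    vacuum φ (inclU φ f) = LinearMap.lTensor (ExteriorAlgebra k g) (fockMap φ) f := by
  induction f using TensorProduct.induction_on with
  | zero => simp
  | add a c ha hc => simp only [map_add, ha, hc]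
  | tmul ω u => rw [vacuum_inclU_tmul, LinearMap.lTensor_tmul]

theorem vacuum_mul (F G : ExtForms φ) :
    vacuum φ (F * G) = fock k g n (realize φ F) (vacuum φ G) := by
  change fock k g n (realize φ (F * G)) (1 ⊗ₜ 1) = fock k g n (realize φ F)
    (fock k g n (realize φ G) (1 ⊗ₜ 1))
  rw [map_mul, map_mul]
  rfl

theorem realize_dx (j : Fin n) :
    realize φ (dx b φ j) = ExteriorAlgebra.ι k (b j) ⊗ₜ 1 := by
  rw [realize, dx, Algebra.TensorProduct.map_tmul, map_one]
  rfl

theorem realize_ofSeries (P : MvPowerSeries (Fin n) k) :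
    realize φ (ofSeries φ P) = 1 ⊗ₜ weylD k P := by
  change (1 : ExteriorAlgebra k g) ⊗ₜ realizeSmashLin φ (Smash.mk φ 1 P) = _
  rw [realizeSmashLin_mk, map_one, one_mul]

theorem partialHat_inclU_tmul
    (ξ : MvPolynomial (Fin n) k ≃ₗ[k] UniversalEnvelopingAlgebra k g) (j : Fin n)
    (ω : ExteriorAlgebra k g) (u : UniversalEnvelopingAlgebra k g) :
    partialHat φ ξ j (inclU φ (ω ⊗ₜ u)) = inclU φ (ω ⊗ₜ partialHatU ξ j u) := rfl

/-- With `d̂ = ∑_j dx_j ∂̂^j` the two sides agree term by term, since `fockMap` is `ξ⁻¹` and so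
intertwines `∂̂^j` with `∂^j`. -/
theorem CloseToIdentity.vacuum_dHat (hφ : CloseToIdentity b φ) (f : UForms k g) :
    vacuum φ (dHat b φ hφ.xi (inclU φ f)) = extD b (vacuum φ (inclU φ f)) := by
  induction f using TensorProduct.induction_on with
  | zero => simp
  | add a c ha hc => simp only [map_add, ha, hc]
  | tmul ω u =>
    rw [hφ.dHat_apply, map_sum, extD, LinearMap.sum_apply]
    refine Finset.sum_congr rfl fun j _ => ?_
    rw [partialHat_inclU_tmul, vacuum_mul, realize_dx, vacuum_inclU_tmul, vacuum_inclU_tmul,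
      fock_tmul, TensorProduct.map_tmul, LinearMap.mulLeft_apply, ← hφ.xi_symm_apply,
      ← hφ.xi_symm_apply]
    simp [partialHatU]

theorem fock_realize_dxHat (s : Fin n) (ω : ExteriorAlgebra k g) (f : MvPolynomial (Fin n) k) :
    fock k g n (realize φ (dxHat b φ s)) (ω ⊗ₜ f) =
      ∑ j, (ExteriorAlgebra.ι k (b j) * ω) ⊗ₜ diffHom (phiMatrix b φ j s) f := by
  simp only [dxHat, map_sum, map_mul, LinearMap.sum_apply, realize_dx, realize_ofSeries,
    Module.End.mul_apply, fock_tmul, one_mul]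
  rfl

/-- The subspace `Λ_φ(g) |0⟩` of the Fock space. -/
def phiFormsVacuum (b : Module.Basis (Fin n) k g)
    (φ : g →ₗ⁅k⁆ Derivation k (MvPowerSeries (Fin n) k) (MvPowerSeries (Fin n) k)) :
    Submodule k (ExteriorAlgebra k g ⊗[k] MvPolynomial (Fin n) k) :=
  (Subalgebra.toSubmodule (phiForms b φ)).map
    (LinearMap.applyₗ (R := k) (1 ⊗ₜ 1) ∘ₗ (fock k g n).toLinearMap)

theorem fock_mem_phiFormsVacuum {F : ExteriorAlgebra k g ⊗[k] weyl k n} (hF : F ∈ phiForms b φ)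
    {w : ExteriorAlgebra k g ⊗[k] MvPolynomial (Fin n) k} (hw : w ∈ phiFormsVacuum b φ) :
    fock k g n F w ∈ phiFormsVacuum b φ := by
  obtain ⟨G, hG, rfl⟩ := hw
  refine ⟨F * G, (phiForms b φ).mul_mem hF hG, ?_⟩
  change fock k g n (F * G) (1 ⊗ₜ 1) = fock k g n F (fock k g n G (1 ⊗ₜ 1))
  rw [map_mul]
  rfl

theorem one_tmul_realizeU_mem_phiForms (u : UniversalEnvelopingAlgebra k g) :
    (1 : ExteriorAlgebra k g) ⊗ₜ realizeU φ u ∈ phiForms b φ := by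
  have e : ∀ u, (1 : ExteriorAlgebra k g) ⊗ₜ[k] realizeU φ u = realize φ (inclU φ (1 ⊗ₜ u)) := by
    intro u
    change _ = (1 : ExteriorAlgebra k g) ⊗ₜ realizeSmashLin φ (Smash.mk φ u 1)
    rw [realizeSmashLin_mk, map_one, mul_one]
  let ρ : UniversalEnvelopingAlgebra k g →ₐ[k] ExteriorAlgebra k g ⊗[k] weyl k n :=
    Algebra.TensorProduct.includeRight.comp (realizeU φ)
  refine u_induction ((Subalgebra.toSubmodule (phiForms b φ)).comap ρ.toLinearMap) ?_ ?_ u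
  · change ρ 1 ∈ phiForms b φ
    rw [map_one]
    exact one_mem _
  · intro x u hu
    change ρ u ∈ phiForms b φ at hu
    change ρ (UniversalEnvelopingAlgebra.ι k x * u) ∈ phiForms b φ
    rw [map_mul]
    refine mul_mem ?_ hu
    rw [← b.sum_repr x, map_sum, map_sum]
    refine sum_mem fun i _ => ?_
    rw [map_smul, map_smul]
    have hi : ρ (UniversalEnvelopingAlgebra.ι k (b i)) ∈ phiForms b φ :=
      Algebra.subset_adjoin (Or.inr ⟨i, (e _).symm⟩)
    exact (phiForms b φ).smul_mem hi _

/-- The `x̂_i^φ` already produce `1 ⊗ S(g)` from the vacuum, by surjectivity of `fockMap`. The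
`dx̂_i^φ` then build up the exterior factor. The series in `φ⁻¹` need not belong to `Λ_φ(g)`, so
they are applied to the polynomial factor instead. -/
theorem CloseToIdentity.phiFormsVacuum_eq_top (hφ : CloseToIdentity b φ) :
    phiFormsVacuum b φ = ⊤ := by
  classical
  -- Membership requires every `f`, because multiplying `ω` by `dx_l` calls on other polynomials in
  -- the second factor.
  let p : Submodule k (ExteriorAlgebra k g) :=
    { carrier := {ω | ∀ f : MvPolynomial (Fin n) k, ω ⊗ₜ f ∈ phiFormsVacuum b φ}
      add_mem' := fun {a c} ha hc f => by
        rw [TensorProduct.add_tmul]; exact add_mem (ha f) (hc f)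
      zero_mem' := fun f => by rw [TensorProduct.zero_tmul]; exact zero_mem _
      smul_mem' := fun c a ha f => by
        rw [← TensorProduct.smul_tmul']; exact Submodule.smul_mem _ _ (ha f) }
  have h1 : (1 : ExteriorAlgebra k g) ∈ p := by
    intro f
    obtain ⟨u, rfl⟩ := hφ.fockMap_bijective.2 f
    refine ⟨_, one_tmul_realizeU_mem_phiForms u, ?_⟩
    change fock k g n (1 ⊗ₜ realizeU φ u) (1 ⊗ₜ 1) = _
    rw [fock_tmul, mul_one, fockMap_apply]
  have hb : ∀ l, ∀ ω ∈ p, ExteriorAlgebra.ι k (b l) * ω ∈ p := by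
    intro l ω hω f
    have hmem : ∀ i, realize φ (dxHat b φ i) ∈ phiForms b φ := fun i =>
      Algebra.subset_adjoin (Or.inl ⟨i, rfl⟩)
    -- The sum equals `dx_l ω ⊗ f`: the operators `φ^j_i` coming from `dx̂_i^φ` meet the column `l`
    -- of `φ⁻¹` and leave `δ^j_l`.
    have h2 : ∑ i, fock k g n (realize φ (dxHat b φ i))
        (ω ⊗ₜ diffHom ((phiMatrix b φ)⁻¹ i l) f) ∈ phiFormsVacuum b φ :=
      sum_mem fun i _ => fock_mem_phiFormsVacuum (hmem i) (hω _)
    have e : ∀ j, ∑ i, diffHom (phiMatrix b φ j i) (diffHom ((phiMatrix b φ)⁻¹ i l) f) =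
        if j = l then f else 0 := by
      intro j
      have h3 := congrArg (fun P => diffHom P f)
        (congrFun (congrFun hφ.phiMatrix_mul_inv j) l)
      simp only [Matrix.mul_apply, Matrix.one_apply, map_sum, map_mul, LinearMap.sum_apply,
        Module.End.mul_apply] at h3
      rw [h3]
      split_ifs <;> simp
    simp only [fock_realize_dxHat] at h2
    rw [Finset.sum_comm] at h2
    simp only [← TensorProduct.tmul_sum, e] at h2
    simpa [TensorProduct.tmul_ite] using h2
  have hx : ∀ x : g, ∀ ω ∈ p, ExteriorAlgebra.ι k x * ω ∈ p := by
    intro x ω hω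
    rw [← b.sum_repr x, map_sum, Finset.sum_mul]
    refine sum_mem fun i _ => ?_
    rw [map_smul, smul_mul_assoc]
    exact p.smul_mem _ (hb i ω hω)
  have hp : ∀ ω, ω ∈ p := by
    intro ω
    -- Stability of `p` under left multiplication by `ω`, unlike membership of `ω`, passes to
    -- products.
    suffices H : ∀ η ∈ p, ω * η ∈ p by simpa using H 1 h1
    induction ω using ExteriorAlgebra.induction with
    | algebraMap r => intro η hη; rw [← Algebra.smul_def]; exact p.smul_mem r hη
    | ι x => exact hx x
    | mul a c ha hc => intro η hη; rw [mul_assoc]; exact ha _ (hc _ hη)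
    | add a c ha hc => intro η hη; rw [add_mul]; exact add_mem (ha _ hη) (hc _ hη)
  rw [eq_top_iff, ← TensorProduct.span_tmul_eq_top, Submodule.span_le]
  rintro _ ⟨ω, f, rfl⟩
  exact hp ω f

end Forms

end

end TwistedForms

/-! ### The main theorem -/

open scoped TensorProduct in
theorem theorem3p6 {k : Type*} [Field k] [CharZero k]
    {g : Type*} [LieRing g] [LieAlgebra k g] {n : ℕ} (b : Module.Basis (Fin n) k g)
    (φ : g →ₗ⁅k⁆ Derivation k (MvPowerSeries (Fin n) k) (MvPowerSeries (Fin n) k))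
    (hφ : TwistedForms.CloseToIdentity b φ) :
    ∃ ξ : MvPolynomial (Fin n) k ≃ₗ[k] UniversalEnvelopingAlgebra k g,
      TwistedForms.IsXi b φ ξ ∧ (∀ ξ', TwistedForms.IsXi b φ ξ' → ξ' = ξ) ∧
      (Function.Bijective
          (fun f : TwistedForms.UForms k g => TwistedForms.vacuum φ (TwistedForms.inclU φ f)) ∧
        (∀ f : TwistedForms.UForms k g,
          LinearMap.lTensor (ExteriorAlgebra k g) ξ.toLinearMap
            (TwistedForms.vacuum φ (TwistedForms.inclU φ f)) = f) ∧
        (∀ w : ExteriorAlgebra k g ⊗[k] MvPolynomial (Fin n) k,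
          TwistedForms.vacuum φ (TwistedForms.inclU φ
            (LinearMap.lTensor (ExteriorAlgebra k g) ξ.toLinearMap w)) = w) ∧
        (fun F => TwistedForms.fock k g n F (1 ⊗ₜ 1)) ''
          (TwistedForms.phiForms b φ : Set (ExteriorAlgebra k g ⊗[k] TwistedForms.weyl k n)) =
            Set.univ) ∧
      (∀ (f : TwistedForms.UForms k g) (s : Fin n),
        TwistedForms.dHat b φ ξ (TwistedForms.dxHat b φ s * TwistedForms.inclU φ f) =
            -(TwistedForms.dxHat b φ s * TwistedForms.dHat b φ ξ (TwistedForms.inclU φ f)) ∧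
          TwistedForms.dHat b φ ξ (TwistedForms.dx b φ s * TwistedForms.inclU φ f) =
            -(TwistedForms.dx b φ s * TwistedForms.dHat b φ ξ (TwistedForms.inclU φ f))) ∧
      (∀ f : TwistedForms.UForms k g,
        TwistedForms.vacuum φ (TwistedForms.dHat b φ ξ (TwistedForms.inclU φ f)) =
          TwistedForms.extD b (TwistedForms.vacuum φ (TwistedForms.inclU φ f))) := by
  have hvac : ∀ f : TwistedForms.UForms k g, LinearMap.lTensor (ExteriorAlgebra k g)
      hφ.xi.toLinearMap (TwistedForms.vacuum φ (TwistedForms.inclU φ f)) = f := fun f => by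
    rw [TwistedForms.vacuum_inclU, ← LinearMap.comp_apply, ← LinearMap.lTensor_comp]
    have : hφ.xi.toLinearMap ∘ₗ TwistedForms.fockMap φ = LinearMap.id :=
      LinearMap.ext hφ.xi.apply_symm_apply
    rw [this, LinearMap.lTensor_id, LinearMap.id_apply]
  have hxi : ∀ w : ExteriorAlgebra k g ⊗[k] MvPolynomial (Fin n) k,
      TwistedForms.vacuum φ (TwistedForms.inclU φ
        (LinearMap.lTensor (ExteriorAlgebra k g) hφ.xi.toLinearMap w)) = w := fun w => by
    rw [TwistedForms.vacuum_inclU, ← LinearMap.comp_apply, ← LinearMap.lTensor_comp]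
    have : TwistedForms.fockMap φ ∘ₗ hφ.xi.toLinearMap = LinearMap.id :=
      LinearMap.ext hφ.xi.symm_apply_apply
    rw [this, LinearMap.lTensor_id, LinearMap.id_apply]
  refine ⟨hφ.xi, hφ.isXi, fun ξ' hξ' => hξ'.eq_xi hφ, ⟨?_, hvac, hxi, ?_⟩, fun f s =>
    ⟨hφ.isXi.dHat_dxHat_mul hφ s _, hφ.dHat_dx_mul _ s _⟩, hφ.vacuum_dHat⟩
  · exact Function.bijective_iff_has_inverse.2 ⟨_, hvac, hxi⟩
  · exact congrArg (SetLike.coe (B := ExteriorAlgebra k g ⊗[k] MvPolynomial (Fin n) k))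
      hφ.phiFormsVacuum_eq_top
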